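/- Let $M\ge 1$ and let $f_1,\dots,f_M$ be probability densities on $\mathbb R$ (with respect to Lebesgue measure). Put $f_m(x;\mu,\sigma)=\frac1\sigma f_m\!\left(\frac{x-\mu}{\sigma}\right)$ for $\mu\in\mathbb R$, $\sigma>0$, and for $\theta=(\alpha_m,\mu_m,\sigma_m)_{m=1}^M$ in $$\Theta=\Big\{\theta\in\mathbb R^{3M} : \alpha_m\ge 0,\ \sum_{m=1}^M\alpha_m=1,\ \mu_m\in\mathbb R,\ \sigma_m>0\Big\}$$ (with the Euclidean distance) let $f(x;\theta)=\sum_{m=1}^M\alpha_m f_m(x;\mu_m,\sigma_m)$. For $k\le M$ let $\mathscr G_k$ be the set of densities that agree almost everywhere with some $f(\cdot;\theta)$, $\theta\in\Theta$, having at most $k$ nonzero weights $\alpha_m$. Let $\theta_0\in\Theta$ and assume: 1. for every compact $\Gamma\subset\Theta$, every $\theta\in\Gamma$ and all sufficiently small $\rho>0$, the function $x\mapsto\sup\{f(x;\theta') : \theta'\in\Theta,\ \mathrm{dist}(\theta',\theta)\le\rho\}$ is measurable; 2. for every compact $\Gamma\subset\Theta$ and every $\theta\in\Gamma$ there is a Lebesgue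 null set $N$ such that $f(x;\theta^{(j)})\to f(x;\theta)$ for all $x\notin N$ and every sequence $\theta^{(j)}\in\Gamma$ with $\theta^{(j)}\to\theta$; 3. $\int|\log f(x;\theta_0)|\,f(x;\theta_0)\,dx<\infty$; 4. there are real constants $v_0,v_1>0$ and $\beta>2$ with $f_m(x)\le\min\{v_0,\,v_1|x|^{-\beta}\}$ for all $m$ and $x$ (where $|0|^{-\beta}=\infty$); 5. $f(\cdot;\theta_0)\in\mathscr G_M\setminus\mathscr G_{M-1}$. Let $X_1,X_2,\dots$ be independent with density $f(\cdot;\theta_0)$, let $b_0>0$ and $0<\tilde d<1$, put $b_n=b_0\exp(-n^{\tilde d})$ and $$\Theta_{b_n}=\Big\{\theta\in\Theta : \frac{\min_m\sigma_m}{\max_m\sigma_m}\ge b_n\Big\}.$$ Let $\hat\theta_n$ be a constrained maximum likelihood estimator, that is, almost surely, for all sufficiently large $n$, $\hat\theta_n\in\Theta_{b_n}$ and $\hat\theta_n$ maximizes $\prod_{i=1}^n f(X_i;\theta)$ over $\theta\in\Theta_{b_n}$. Then $\hat\theta_n$ is strongly consistent: writing $\Theta(\theta')=\{\theta\in\Theta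 : f(\cdot;\theta)=f(\cdot;\theta')\text{ almost everywhere}\}$ and $\mathrm{dist}(U,V)=\inf_{\theta\in U,\,\theta'\in V}\mathrm{dist}(\theta,\theta')$, $$\mathrm{Prob}\Big(\lim_{n\to\infty}\mathrm{dist}\big(\Theta(\hat\theta_n),\Theta(\theta_0)\big)=0\Big)=1 .$$ -/

import Mathlib

open MeasureTheory ProbabilityTheory Filter Topology

namespace LocScaleMixture

noncomputable section

/-- Parameter vectors `(α₁, …, α_M, μ₁, …, μ_M, σ₁, …, σ_M)` in `ℝ^(3M)` with the Euclidean distance. -/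
abbrev Param (M : ℕ) : Type := EuclideanSpace ℝ (Fin 3 × Fin M)

/-- The mixing weight `α_m`. -/
def weight {M : ℕ} (θ : Param M) (m : Fin M) : ℝ := θ (0, m)

/-- The location parameter `μ_m`. -/
def loc {M : ℕ} (θ : Param M) (m : Fin M) : ℝ := θ (1, m)

/-- The scale parameter `σ_m`. -/
def scale {M : ℕ} (θ : Param M) (m : Fin M) : ℝ := θ (2, m)

/-- The parameter space `Θ`. -/
def paramSpace (M : ℕ) : Set (Param M) :=
  {θ | (∀ m, 0 ≤ weight θ m) ∧ ∑ m, weight θ m = 1 ∧ ∀ m, 0 < scale θ m}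

/-- A probability density on the real line (with respect to Lebesgue measure). -/
structure IsDensity (g : ℝ → ℝ) : Prop where
  nonneg : ∀ x, 0 ≤ g x
  integrable : Integrable g volume
  integral_eq_one : ∫ x, g x = 1

/-- The location-scale density `f(x; μ, σ)` generated by the standard density `g = f(·; 0, 1)`. -/
def locScale (g : ℝ → ℝ) (μ σ x : ℝ) : ℝ := 1 / σ * g ((x - μ) / σ)

/-- The mixture density `f(x; θ)`, where `f m` is the standard density of the `m`-th component. -/
def mixture {M : ℕ} (f : Fin M → ℝ → ℝ) (θ : Param M) (x : ℝ) : ℝ :=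
  ∑ m, weight θ m * locScale (f m) (loc θ m) (scale θ m) x

/-- The set `𝒢_k` of mixture densities with at most `k` components, that is, with at most `k`
nonzero weights; densities that agree almost everywhere are identified. -/
def mixtureClass {M : ℕ} (f : Fin M → ℝ → ℝ) (k : ℕ) : Set (ℝ → ℝ) :=
  {g | ∃ θ ∈ paramSpace M, {m : Fin M | weight θ m ≠ 0}.ncard ≤ k ∧
    g =ᵐ[volume] mixture f θ}

/-- `σ_(1)`, the smallest scale parameter. -/
def scaleMin {M : ℕ} (θ : Param M) : ℝ := ⨅ m, scale θ m

/-- `σ_(M)`, the largest scale parameter. -/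
def scaleMax {M : ℕ} (θ : Param M) : ℝ := ⨆ m, scale θ m

/-- The constrained parameter space `{θ ∈ Θ | σ_(1) / σ_(M) ≥ b}`. -/
def ratioSpace (M : ℕ) (b : ℝ) : Set (Param M) :=
  {θ | θ ∈ paramSpace M ∧ b ≤ scaleMin θ / scaleMax θ}

/-- `f(x; θ, ρ)`, the supremum of `f(x; θ')` over `θ' ∈ Θ` with `dist(θ', θ) ≤ ρ`, taken
in `[0, ∞]`. -/
def supMixture {M : ℕ} (f : Fin M → ℝ → ℝ) (θ : Param M) (ρ : ℝ) (x : ℝ) : ENNReal :=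
  ⨆ θ' ∈ {θ' : Param M | θ' ∈ paramSpace M ∧ dist θ' θ ≤ ρ}, ENNReal.ofReal (mixture f θ' x)

/-- For each `θ` in a compact subset of `Θ` and all sufficiently small `ρ`, `f(·; θ, ρ)` is
(Lebesgue) measurable. -/
def SupIsMeasurable {M : ℕ} (f : Fin M → ℝ → ℝ) : Prop :=
  ∀ Γ : Set (Param M), IsCompact Γ → Γ ⊆ paramSpace M → ∀ θ ∈ Γ,
    ∃ ρ₀ : ℝ, 0 < ρ₀ ∧ ∀ ρ : ℝ, 0 < ρ → ρ < ρ₀ → AEMeasurable (supMixture f θ ρ) volume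

/-- `θ ↦ f(x; θ)` is sequentially continuous at each `θ` of a compact subset of `Θ`, for all `x`
outside a null set that does not depend on the sequence. -/
def ContinuousInParam {M : ℕ} (f : Fin M → ℝ → ℝ) : Prop :=
  ∀ Γ : Set (Param M), IsCompact Γ → Γ ⊆ paramSpace M → ∀ θ ∈ Γ,
    ∃ N : Set ℝ, volume N = 0 ∧
      ∀ s : ℕ → Param M, (∀ j, s j ∈ Γ) → Tendsto s atTop (𝓝 θ) →
        ∀ x, x ∉ N → Tendsto (fun j => mixture f (s j) x) atTop (𝓝 (mixture f θ x))

/-- `∫ |log f(x; θ₀)| f(x; θ₀) dx < ∞`. -/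
def FiniteLogIntegral {M : ℕ} (f : Fin M → ℝ → ℝ) (θ₀ : Param M) : Prop :=
  Integrable (fun x => |Real.log (mixture f θ₀ x)| * mixture f θ₀ x) volume

/-- There are `v₀, v₁ > 0` and `β > 2` with `f_m(x; 0, 1) ≤ min {v₀, v₁ |x|^(-β)}` for all `m`
and `x`, where `|0|^(-β) = ∞`. -/
def TailBound {M : ℕ} (f : Fin M → ℝ → ℝ) : Prop :=
  ∃ v₀ v₁ β : ℝ, 0 < v₀ ∧ 0 < v₁ ∧ 2 < β ∧
    ∀ m x, f m x ≤ v₀ ∧ (x ≠ 0 → f m x ≤ v₁ * |x| ^ (-β))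

/-- `X 0, X 1, …` are independent with common density `g` under `P`. -/
structure IsIIDSample {Ω : Type*} [MeasurableSpace Ω] (P : Measure Ω) (X : ℕ → Ω → ℝ)
    (g : ℝ → ℝ) : Prop where
  measurable : ∀ i, Measurable (X i)
  indep : iIndepFun X P
  law : ∀ i, P.map (X i) = volume.withDensity (fun x => ENNReal.ofReal (g x))

/-- The likelihood of `θ` for the first `n` observations of `x`. -/
def likelihood {M : ℕ} (f : Fin M → ℝ → ℝ) (n : ℕ) (x : ℕ → ℝ) (θ : Param M) : ℝ :=
  ∏ i ∈ Finset.range n, mixture f θ (x i)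

/-- `θ` maximizes the likelihood for the first `n` observations of `x` over the set `S`. -/
def IsMLE {M : ℕ} (f : Fin M → ℝ → ℝ) (S : Set (Param M)) (n : ℕ) (x : ℕ → ℝ)
    (θ : Param M) : Prop :=
  θ ∈ S ∧ IsMaxOn (likelihood f n x) S θ

/-- `Θ(θ')`, the set of parameters whose density equals `f(·; θ')` almost everywhere. -/
def equivParams {M : ℕ} (f : Fin M → ℝ → ℝ) (θ' : Param M) : Set (Param M) :=
  {θ | θ ∈ paramSpace M ∧ mixture f θ =ᵐ[volume] mixture f θ'}

/-- `dist(U, V)`, the infimum of the distances between points of `U` and points of `V`. -/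
def setDist {M : ℕ} (U V : Set (Param M)) : ENNReal := ⨅ θ ∈ U, ⨅ θ' ∈ V, edist θ θ'

/-- Strong consistency: `dist(Θ(θ̂_n), Θ(θ₀)) → 0` almost surely. -/
def StronglyConsistent {M : ℕ} {Ω : Type*} [MeasurableSpace Ω] (P : Measure Ω)
    (f : Fin M → ℝ → ℝ) (θ₀ : Param M) (est : ℕ → Ω → Param M) : Prop :=
  ∀ᵐ ω ∂P, Tendsto (fun n => setDist (equivParams f (est n ω)) (equivParams f θ₀)) atTop (𝓝 0)

end

end LocScaleMixture

open LocScaleMixture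

/-!
The proof bounds Hellinger affinities. Write `w = √f(·; θ₀)`. For a function `q` that dominates
`√f(·; θ)` for all `θ` in some set, independence and Markov's inequality show that the likelihood of
some `θ` in that set reaches the likelihood of `θ₀` with probability at most `(∫ q w) ^ n`
(`measure_one_le_prod_le`). So it is enough to cover the parameters that are away from the truth by
subexponentially many such `q`, with `∫ q w ≤ c < 1` (`UpperCover`), and to apply Borel–Cantelli.

The tail exponent `β > 2` makes `w` integrable and gives a component with scale `σ` an affinity
`O(√σ)` with the truth. Components with a small scale, a large scale or a far location therefore
contribute little, and those with scale at least `2 ^ (-k)` need a cover of size only exponential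
in `k` (`exists_upperCover_outside`). What remains of the mixture, once the weight of such
degenerate components is handed to another one, is a mixture with a vanishing weight. It is not the
true density, which needs all `M` components. Such mixtures, and those away from the truth without
degenerate components, have parameters in a compact set, where the continuity hypotheses and the
strict Cauchy–Schwarz inequality give finitely many `q` with `∫ q w < 1`
(`RootTail.exists_upperCover_of_isCompact`). How degenerate a component has to be depends on the
gap `1 - c` of the compact set, and conversely; a pigeonhole argument on `M + 1` nested boxes
resolves this (`exists_upperCover_awayParams`).

Since the scales under the constraint are at least `2 ^ (-k n)` times the largest one, with
`k n = o(n)` because the exponent `d` is less than `1`, the covers have subexponential size when the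
largest scale is bounded below. When it is about `2 ^ (-j)` with `j` large, all components are small,
and the affinity `O(2 ^ (-j / 2))` makes the probabilities summable over `j` and `n`
(`exists_ae_eventually_notMem_exceedSet`).
-/

namespace LocScaleMixture

open scoped ENNReal

/-! ### Upper bracketing covers -/

/-- The functions in `F` are dominated by at most `N` functions `q`, each of them
almost everywhere measurable with `∫ q w ≤ c`.  The functions in `F` play the role of square roots
of densities and `w` that of the square root of the true density, so that `∫ q w` is a Hellinger
affinity. -/
def UpperCover (w : ℝ → ℝ≥0∞) (c : ℝ≥0∞) (N : ℕ) (F : Set (ℝ → ℝ≥0∞)) : Prop :=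
  ∃ Q : Finset (ℝ → ℝ≥0∞), Q.card ≤ N ∧
    (∀ q ∈ Q, AEMeasurable q volume ∧ ∫⁻ x, q x * w x ≤ c) ∧ ∀ g ∈ F, ∃ q ∈ Q, g ≤ q

namespace UpperCover

variable {w : ℝ → ℝ≥0∞} {c c' : ℝ≥0∞} {N N' : ℕ} {F F' : Set (ℝ → ℝ≥0∞)}

lemma mono (h : UpperCover w c N F) (hc : c ≤ c') (hN : N ≤ N')
    (hF : ∀ g ∈ F', ∃ h ∈ F, g ≤ h) : UpperCover w c' N' F' := by
  obtain ⟨Q, h1, h2, h3⟩ := h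
  refine ⟨Q, h1.trans hN, fun q hq => ⟨(h2 q hq).1, (h2 q hq).2.trans hc⟩, fun g hg => ?_⟩
  obtain ⟨k, hk, hgk⟩ := hF g hg
  obtain ⟨q, hq, hkq⟩ := h3 k hk
  exact ⟨q, hq, hgk.trans hkq⟩

lemma subset (h : UpperCover w c N F) (hF : F' ⊆ F) : UpperCover w c N F' :=
  h.mono le_rfl le_rfl fun g hg => ⟨g, hF hg, le_rfl⟩

lemma single {q : ℝ → ℝ≥0∞} (hq : AEMeasurable q volume) (hc : ∫⁻ x, q x * w x ≤ c)
    (hF : ∀ g ∈ F, g ≤ q) : UpperCover w c 1 F :=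
  ⟨{q}, by simp, by simpa using ⟨hq, hc⟩, fun g hg => ⟨q, by simp, hF g hg⟩⟩

lemma union (h : UpperCover w c N F) (h' : UpperCover w c N' F') :
    UpperCover w c (N + N') (F ∪ F') := by
  classical
  obtain ⟨Q, h1, h2, h3⟩ := h
  obtain ⟨Q', h1', h2', h3'⟩ := h'
  refine ⟨Q ∪ Q', (Finset.card_union_le _ _).trans (by omega), fun q hq => ?_, ?_⟩
  · rcases Finset.mem_union.1 hq with hq | hq
    · exact h2 q hq
    · exact h2' q hq
  · rintro g (hg | hg)
    · obtain ⟨q, hq, hgq⟩ := h3 g hg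
      exact ⟨q, Finset.mem_union_left _ hq, hgq⟩
    · obtain ⟨q, hq, hgq⟩ := h3' g hg
      exact ⟨q, Finset.mem_union_right _ hq, hgq⟩

lemma biUnion {ι : Type*} (s : Finset ι) {n : ι → ℕ} {G : ι → Set (ℝ → ℝ≥0∞)}
    (h : ∀ i ∈ s, UpperCover w c (n i) (G i)) :
    UpperCover w c (∑ i ∈ s, n i) (⋃ i ∈ s, G i) := by
  classical
  induction s using Finset.induction_on with
  | empty => exact ⟨∅, by simp⟩
  | insert a s ha ih =>
    rw [Finset.sum_insert ha, Finset.set_biUnion_insert]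
    exact (h a (Finset.mem_insert_self _ _)).union
      (ih fun i hi => h i (Finset.mem_insert_of_mem hi))

lemma add (hw : AEMeasurable w volume) (h : UpperCover w c N F) (h' : UpperCover w c' N' F') :
    UpperCover w (c + c') (N * N') {g | ∃ g₁ ∈ F, ∃ g₂ ∈ F', g = g₁ + g₂} := by
  classical
  obtain ⟨Q, h1, h2, h3⟩ := h
  obtain ⟨Q', h1', h2', h3'⟩ := h'
  refine ⟨(Q ×ˢ Q').image fun p => p.1 + p.2, ?_, fun q hq => ?_, ?_⟩
  · exact Finset.card_image_le.trans (by rw [Finset.card_product]; exact Nat.mul_le_mul h1 h1')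
  · obtain ⟨⟨q₁, q₂⟩, hp, rfl⟩ := Finset.mem_image.1 hq
    obtain ⟨hq₁, hq₂⟩ := Finset.mem_product.1 hp
    refine ⟨(h2 _ hq₁).1.add (h2' _ hq₂).1, ?_⟩
    simp only [Pi.add_apply, add_mul]
    rw [lintegral_add_left'
      (show AEMeasurable (fun x => q₁ x * w x) volume from (h2 _ hq₁).1.mul hw)]
    exact add_le_add (h2 _ hq₁).2 (h2' _ hq₂).2
  · rintro g ⟨g₁, hg₁, g₂, hg₂, rfl⟩
    obtain ⟨q₁, hq₁, hle₁⟩ := h3 g₁ hg₁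
    obtain ⟨q₂, hq₂, hle₂⟩ := h3' g₂ hg₂
    exact ⟨q₁ + q₂, Finset.mem_image.2 ⟨(q₁, q₂), Finset.mem_product.2 ⟨hq₁, hq₂⟩, rfl⟩,
      add_le_add hle₁ hle₂⟩

/-- A sum of `s.card` functions of `F` is covered by sums of covering functions. -/
lemma sum {ι : Type*} (hw : AEMeasurable w volume) (h : UpperCover w c N F) (s : Finset ι) :
    UpperCover w (s.card * c) (N ^ s.card)
      {g | ∃ k : ι → ℝ → ℝ≥0∞, (∀ i ∈ s, k i ∈ F) ∧ g = ∑ i ∈ s, k i} := by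
  classical
  induction s using Finset.induction_on with
  | empty =>
    refine (single (q := 0) aemeasurable_const (by simp) ?_).mono le_rfl (by simp)
      (F := {0}) (fun g hg => ⟨g, ?_, le_rfl⟩)
    · rintro g rfl; exact le_rfl
    · obtain ⟨k, -, rfl⟩ := hg; simp
  | insert a s ha ih =>
    refine (h.add hw ih).mono ?_ ?_ ?_
    · rw [Finset.card_insert_of_notMem ha]; push_cast; rw [add_mul, one_mul, add_comm]
    · rw [Finset.card_insert_of_notMem ha, pow_succ, mul_comm]
    · rintro g ⟨k, hk, rfl⟩
      refine ⟨_, ⟨k a, hk a (Finset.mem_insert_self _ _), ∑ i ∈ s, k i,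
        ⟨k, fun i hi => hk i (Finset.mem_insert_of_mem hi), rfl⟩, rfl⟩, ?_⟩
      rw [Finset.sum_insert ha]

end UpperCover

/-! ### The union bound for likelihood ratios -/

section Deviation

variable {Ω : Type*} [MeasurableSpace Ω] {P : Measure Ω} {X : ℕ → Ω → ℝ} {f₀ : ℝ → ℝ}

/-- The law of an observation is absolutely continuous, so almost everywhere properties hold at all
the observations. -/
lemma IsIIDSample.ae_all (hX : IsIIDSample P X f₀) {p : ℝ → Prop} (hp : ∀ᵐ x, p x) :
    ∀ᵐ ω ∂P, ∀ i, p (X i ω) := by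
  rw [ae_all_iff]
  intro i
  refine ae_of_ae_map (hX.measurable i).aemeasurable ?_
  rw [hX.law i]
  exact (withDensity_absolutelyContinuous _ _) hp

/-- The true density is positive at all the observations, almost surely. -/
lemma IsIIDSample.ae_pos (hX : IsIIDSample P X f₀) (hf₀ : AEMeasurable f₀ volume) :
    ∀ᵐ ω ∂P, ∀ i, 0 < f₀ (X i ω) := by
  rw [ae_all_iff]
  intro i
  refine ae_of_ae_map (p := fun x => 0 < f₀ x) (hX.measurable i).aemeasurable ?_
  rw [hX.law i, ae_withDensity_iff_ae_restrict' hf₀.ennreal_ofReal]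
  have : ∀ᵐ x ∂(volume.restrict {x | ENNReal.ofReal (f₀ x) ≠ 0}), ENNReal.ofReal (f₀ x) ≠ 0 := by
    have hns : NullMeasurableSet {x | ENNReal.ofReal (f₀ x) ≠ 0} volume :=
      (hf₀.ennreal_ofReal.nullMeasurableSet_preimage (measurableSet_singleton 0)).compl
    exact ae_restrict_mem₀ hns
  filter_upwards [this] with x hx
  by_contra h
  exact hx (ENNReal.ofReal_of_nonpos (not_lt.1 h))

/-- By independence and Markov's inequality, the product of `q / √f₀` over `n` observations
exceeds `1` with probability at most the `n`-th power of `∫ q √f₀`. -/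
lemma measure_one_le_prod_le (hX : IsIIDSample P X f₀) (hf₀ : AEMeasurable f₀ volume)
    {q : ℝ → ℝ≥0∞} (hq : AEMeasurable q volume) (n : ℕ) :
    P {ω | 1 ≤ ∏ i ∈ Finset.range n, q (X i ω) / ENNReal.ofReal √(f₀ (X i ω))} ≤
      (∫⁻ x, q x * ENNReal.ofReal √(f₀ x)) ^ n := by
  set u : ℝ → ℝ≥0∞ := fun x => q x / ENNReal.ofReal √(f₀ x) with hu
  have hum : AEMeasurable u volume := hq.div hf₀.sqrt.ennreal_ofReal
  set v := hum.mk u with hv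
  have hvm : Measurable v := hum.measurable_mk
  have hint : ∀ i, ∫⁻ ω, v (X i ω) ∂P = ∫⁻ x, q x * ENNReal.ofReal √(f₀ x) := by
    intro i
    rw [← lintegral_map hvm (hX.measurable i), hX.law i,
      lintegral_withDensity_eq_lintegral_mul₀ hf₀.ennreal_ofReal hvm.aemeasurable]
    refine lintegral_congr_ae ?_
    filter_upwards [hum.ae_eq_mk] with x hx
    rw [Pi.mul_apply, hv, ← hx, hu]
    dsimp only
    rcases le_or_gt (f₀ x) 0 with h0 | h0
    · rw [ENNReal.ofReal_of_nonpos h0, Real.sqrt_eq_zero_of_nonpos h0]; simp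
    · have hs : ENNReal.ofReal √(f₀ x) ≠ 0 := by simpa using h0
      have hsq : ENNReal.ofReal (f₀ x) = ENNReal.ofReal √(f₀ x) * ENNReal.ofReal √(f₀ x) := by
        rw [← ENNReal.ofReal_mul (Real.sqrt_nonneg _), Real.mul_self_sqrt h0.le]
      rw [hsq, mul_assoc, ENNReal.mul_div_cancel hs ENNReal.ofReal_ne_top, mul_comm]
  have hind : iIndepFun (fun i ω => v (X i ω)) P := hX.indep.comp (fun _ => v) fun _ => hvm
  have hvX : ∀ i, Measurable fun ω => v (X i ω) := fun i => hvm.comp (hX.measurable i)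
  have hsub : P {ω | 1 ≤ ∏ i ∈ Finset.range n, u (X i ω)} ≤
      P {ω | 1 ≤ ∏ i ∈ Finset.range n, v (X i ω)} := by
    refine measure_mono_ae ?_
    filter_upwards [hX.ae_all hum.ae_eq_mk] with ω hω h
    have h' : 1 ≤ ∏ i ∈ Finset.range n, u (X i ω) := h
    simp only [hω] at h'
    exact h'
  refine hsub.trans ?_
  have hmk := mul_meas_ge_le_lintegral₀ (μ := P)
    (Finset.measurable_fun_prod (Finset.range n) fun i _ => hvX i).aemeasurable 1
  rw [one_mul, lintegral_prod_eq_prod_lintegral_of_indepFun _ _ hind hvX] at hmk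
  simpa [hint] using hmk

/-- The event that, for some `g` in `F`, the product of `g / √f₀` over the first `n` observations is
at least `1`. -/
def exceedSet (X : ℕ → Ω → ℝ) (f₀ : ℝ → ℝ) (n : ℕ) (F : Set (ℝ → ℝ≥0∞)) : Set Ω :=
  {ω | ∃ g ∈ F, 1 ≤ ∏ i ∈ Finset.range n, g (X i ω) / ENNReal.ofReal √(f₀ (X i ω))}

lemma UpperCover.measure_exceedSet_le (hX : IsIIDSample P X f₀) (hf₀ : AEMeasurable f₀ volume) {c : ℝ≥0∞}
    {N : ℕ} {F : Set (ℝ → ℝ≥0∞)} (h : UpperCover (fun x => ENNReal.ofReal √(f₀ x)) c N F) (n : ℕ) :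
    P (exceedSet X f₀ n F) ≤ N * c ^ n := by
  obtain ⟨Q, h1, h2, h3⟩ := h
  have hsub : exceedSet X f₀ n F ⊆
      ⋃ q ∈ Q, {ω | 1 ≤ ∏ i ∈ Finset.range n, q (X i ω) / ENNReal.ofReal √(f₀ (X i ω))} := by
    rintro ω ⟨g, hg, hω⟩
    obtain ⟨q, hq, hgq⟩ := h3 g hg
    refine Set.mem_biUnion hq (hω.trans ?_)
    exact Finset.prod_le_prod' fun i _ => ENNReal.div_le_div_right (hgq _) _
  calc _ ≤ _ := measure_mono hsub
    _ ≤ ∑ q ∈ Q, P {ω | 1 ≤ ∏ i ∈ Finset.range n, q (X i ω) / ENNReal.ofReal √(f₀ (X i ω))} :=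
        measure_biUnion_finset_le _ _
    _ ≤ ∑ q ∈ Q, c ^ n := Finset.sum_le_sum fun q hq =>
        (measure_one_le_prod_le hX hf₀ (h2 q hq).1 n).trans (pow_le_pow_left' (h2 q hq).2 n)
    _ ≤ N * c ^ n := by
        rw [Finset.sum_const, nsmul_eq_mul]
        gcongr

end Deviation

/-! ### Square roots of densities and their tails -/

section Roots

variable {M : ℕ} {f : Fin M → ℝ → ℝ}

/-- The square root of the location-scale density `f_m(·; μ, σ)`, with values in `[0, ∞]`. -/
noncomputable def rootComp (f : Fin M → ℝ → ℝ) (m : Fin M) (μ σ : ℝ) : ℝ → ℝ≥0∞ :=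
  fun x => ENNReal.ofReal √(locScale (f m) μ σ x)

/-- The square root of the mixture density `f(·; θ)`, with values in `[0, ∞]`. -/
noncomputable def rootMix (f : Fin M → ℝ → ℝ) (θ : Param M) : ℝ → ℝ≥0∞ :=
  fun x => ENNReal.ofReal √(mixture f θ x)

lemma locScale_nonneg {g : ℝ → ℝ} (hg : ∀ x, 0 ≤ g x) {μ σ : ℝ} (hσ : 0 < σ) (x : ℝ) :
    0 ≤ locScale g μ σ x :=
  mul_nonneg (by positivity) (hg _)

lemma sqrt_add_le_add_sqrt (a b : ℝ) (ha : 0 ≤ a) (hb : 0 ≤ b) : √(a + b) ≤ √a + √b := by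
  rw [Real.sqrt_le_left (by positivity)]
  nlinarith [Real.sq_sqrt ha, Real.sq_sqrt hb, mul_nonneg (Real.sqrt_nonneg a) (Real.sqrt_nonneg b)]

lemma sqrt_sum_le {ι : Type*} (s : Finset ι) (a : ι → ℝ) (ha : ∀ i ∈ s, 0 ≤ a i) :
    √(∑ i ∈ s, a i) ≤ ∑ i ∈ s, √(a i) := by
  classical
  induction s using Finset.induction_on with
  | empty => simp
  | insert i s hi ih =>
    rw [Finset.sum_insert hi, Finset.sum_insert hi]
    have h' : ∀ j ∈ s, 0 ≤ a j := fun j hj => ha j (Finset.mem_insert_of_mem hj)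
    exact (sqrt_add_le_add_sqrt _ _ (ha i (Finset.mem_insert_self _ _))
      (Finset.sum_nonneg h')).trans (add_le_add le_rfl (ih h'))

lemma ofReal_sqrt_sum_le {ι : Type*} (s : Finset ι) (a : ι → ℝ) (ha : ∀ i ∈ s, 0 ≤ a i) :
    ENNReal.ofReal √(∑ i ∈ s, a i) ≤ ∑ i ∈ s, ENNReal.ofReal √(a i) := by
  rw [← ENNReal.ofReal_sum_of_nonneg fun i _ => Real.sqrt_nonneg _]
  exact ENNReal.ofReal_le_ofReal (sqrt_sum_le s a ha)

lemma weight_le_one {θ : Param M} (hθ : θ ∈ paramSpace M) (m : Fin M) : weight θ m ≤ 1 := by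
  rw [← hθ.2.1]
  exact Finset.single_le_sum (f := fun m => weight θ m) (fun i _ => hθ.1 i) (Finset.mem_univ m)

/-- The square roots of all the standard densities are at most `A (1 + |x|) ^ (-(1 + 2 τ))`. -/
def RootTail (f : Fin M → ℝ → ℝ) (A τ : ℝ) : Prop :=
  ∀ m x, √(f m x) ≤ A * (1 + |x|) ^ (-(1 + 2 * τ))

/-- Because `β > 2`, the square roots of the standard densities have integrable tails, with
some decay to spare. -/
lemma TailBound.exists_rootTail (h : TailBound f) : ∃ A τ : ℝ, 0 < A ∧ 0 < τ ∧ RootTail f A τ := by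
  obtain ⟨v₀, v₁, β, h0, h1, hβ, hb⟩ := h
  have hC : 0 < 2 ^ β * max v₀ v₁ := by positivity
  refine ⟨√(2 ^ β * max v₀ v₁), (β / 2 - 1) / 2, Real.sqrt_pos.2 hC, by linarith, fun m x => ?_⟩
  have hx : (0 : ℝ) < 1 + |x| := by positivity
  have key : f m x ≤ 2 ^ β * max v₀ v₁ * (1 + |x|) ^ (-β) := by
    have e : 2 ^ β * (1 + |x|) ^ (-β) = ((1 + |x|) / 2) ^ (-β) := by
      rw [Real.div_rpow hx.le (by norm_num), Real.rpow_neg (by norm_num : (0:ℝ) ≤ 2)]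
      field_simp
    rw [mul_right_comm, e]
    rcases le_or_gt |x| 1 with hx1 | hx1
    · have : 1 ≤ ((1 + |x|) / 2) ^ (-β) :=
        Real.one_le_rpow_of_pos_of_le_one_of_nonpos (by positivity) (by linarith) (by linarith)
      calc f m x ≤ v₀ := (hb m x).1
        _ ≤ max v₀ v₁ := le_max_left _ _
        _ ≤ _ := le_mul_of_one_le_left (by positivity) this
    · have hx0 : x ≠ 0 := by rintro rfl; simp at hx1; linarith
      have : |x| ^ (-β) ≤ ((1 + |x|) / 2) ^ (-β) :=
        Real.rpow_le_rpow_of_nonpos (by positivity) (by linarith) (by linarith)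
      calc f m x ≤ v₁ * |x| ^ (-β) := (hb m x).2 hx0
        _ ≤ max v₀ v₁ * ((1 + |x|) / 2) ^ (-β) := by gcongr; exact le_max_right _ _
        _ = _ := mul_comm _ _
  calc √(f m x) ≤ √(2 ^ β * max v₀ v₁ * (1 + |x|) ^ (-β)) := Real.sqrt_le_sqrt key
    _ = _ := by
      rw [Real.sqrt_mul hC.le, Real.sqrt_eq_rpow ((1 + |x|) ^ (-β)), ← Real.rpow_mul hx.le]
      congr 2; ring

variable {A τ : ℝ}

lemma RootTail.sqrt_locScale_le (h : RootTail f A τ) (m : Fin M) {μ σ : ℝ} (hσ : 0 < σ) (x : ℝ) :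
    √(locScale (f m) μ σ x) ≤ (√σ)⁻¹ * (A * (1 + |x - μ| / σ) ^ (-(1 + 2 * τ))) := by
  rw [locScale, Real.sqrt_mul (by positivity), one_div, Real.sqrt_inv]
  refine mul_le_mul_of_nonneg_left ?_ (by positivity)
  simpa [abs_div, abs_of_pos hσ] using h m ((x - μ) / σ)

lemma RootTail.rootComp_le_const (h : RootTail f A τ) (hA : 0 ≤ A) (hτ : 0 ≤ τ) (m : Fin M)
    {μ σ S : ℝ} (hS : 0 < S) (hσ : S ≤ σ) (x : ℝ) :
    rootComp f m μ σ x ≤ ENNReal.ofReal ((√S)⁻¹ * A) := by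
  have hσ0 := hS.trans_le hσ
  refine ENNReal.ofReal_le_ofReal ((h.sqrt_locScale_le m hσ0 x).trans ?_)
  have h1 : (1 + |x - μ| / σ) ^ (-(1 + 2 * τ)) ≤ 1 :=
    Real.rpow_le_one_of_one_le_of_nonpos (le_add_of_nonneg_right (by positivity)) (by linarith)
  have h2 : (√σ)⁻¹ ≤ (√S)⁻¹ := by gcongr
  calc _ ≤ (√S)⁻¹ * (A * 1) := by gcongr
    _ = _ := by rw [mul_one]

/-- The square root of a fixed mixture density has the same tails as the standard densities. -/
lemma RootTail.exists_rootMix_le (h : RootTail f A τ) (hf : ∀ m x, 0 ≤ f m x) (hA : 0 ≤ A)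
    (hτ : 0 ≤ τ) {θ : Param M} (hθ : θ ∈ paramSpace M) :
    ∃ D : ℝ, 0 ≤ D ∧ ∀ x, rootMix f θ x ≤ ENNReal.ofReal (D * (1 + |x|) ^ (-(1 + 2 * τ))) := by
  have key : ∀ m x, √(weight θ m * locScale (f m) (loc θ m) (scale θ m) x) ≤
      (√(scale θ m))⁻¹ * A * (1 + |loc θ m| + scale θ m) ^ (1 + 2 * τ) *
        (1 + |x|) ^ (-(1 + 2 * τ)) := by
    intro m x
    have hσ := hθ.2.2 m
    set σ := scale θ m
    set μ := loc θ m
    have h1 : √(weight θ m * locScale (f m) μ σ x) ≤ √(locScale (f m) μ σ x) :=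
      Real.sqrt_le_sqrt (mul_le_of_le_one_left (locScale_nonneg (hf m) hσ x) (weight_le_one hθ m))
    refine (h1.trans (h.sqrt_locScale_le m hσ x)).trans ?_
    have hu : |x| ≤ |x - μ| + |μ| := by simpa using abs_add_le (x - μ) μ
    have h2 : (1 + |x|) / (1 + |μ| + σ) ≤ 1 + |x - μ| / σ := by
      rw [div_le_iff₀ (by positivity)]
      have : (1 + |x - μ| / σ) * (1 + |μ| + σ) =
          1 + |μ| + σ + |x - μ| / σ * (1 + |μ|) + |x - μ| := by field_simp; ring
      rw [this]
      have : 0 ≤ |x - μ| / σ * (1 + |μ|) := by positivity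
      linarith
    have h3 : (1 + |x - μ| / σ) ^ (-(1 + 2 * τ)) ≤
        (1 + |μ| + σ) ^ (1 + 2 * τ) * (1 + |x|) ^ (-(1 + 2 * τ)) := by
      refine (Real.rpow_le_rpow_of_nonpos (by positivity) h2 (by linarith)).trans_eq ?_
      rw [Real.div_rpow (by positivity) (by positivity),
        Real.rpow_neg (by positivity : 0 ≤ 1 + |μ| + σ), div_inv_eq_mul, mul_comm]
    calc _ ≤ (√σ)⁻¹ * (A * ((1 + |μ| + σ) ^ (1 + 2 * τ) * (1 + |x|) ^ (-(1 + 2 * τ)))) := by gcongr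
      _ = _ := by ring
  refine ⟨∑ m, (√(scale θ m))⁻¹ * A * (1 + |loc θ m| + scale θ m) ^ (1 + 2 * τ),
    Finset.sum_nonneg fun m _ => ?_, fun x => ?_⟩
  · have := hθ.2.2 m; positivity
  · refine ENNReal.ofReal_le_ofReal ?_
    rw [Finset.sum_mul, mixture]
    exact (sqrt_sum_le _ _ fun m _ => mul_nonneg (hθ.1 m)
      (locScale_nonneg (hf m) (hθ.2.2 m) x)).trans (Finset.sum_le_sum fun m _ => key m x)

/-- The square root of a component density with a bounded scale decays in the location, up to the
slowly growing factor `(1 + |x|) ^ τ`. -/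
lemma RootTail.rootComp_le_far (h : RootTail f A τ) (hA : 0 ≤ A) (hτ : 0 ≤ τ) (m : Fin M)
    {μ σ s S T : ℝ} (hs : 0 < s) (hσ : s ≤ σ) (hσS : σ ≤ S) (hS : 1 ≤ S) (hT : 0 < T)
    (hμ : T ≤ 1 + |μ|) (x : ℝ) :
    rootComp f m μ σ x ≤
      ENNReal.ofReal ((√s)⁻¹ * A * S ^ τ * T ^ (-τ) * (1 + |x|) ^ τ) := by
  have hσ0 := hs.trans_le hσ
  refine ENNReal.ofReal_le_ofReal ((h.sqrt_locScale_le m hσ0 x).trans ?_)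
  have h1 : (1 + |x - μ| / σ) ^ (-(1 + 2 * τ)) ≤ (1 + |x - μ| / σ) ^ (-τ) :=
    Real.rpow_le_rpow_of_exponent_le (le_add_of_nonneg_right (by positivity)) (by linarith)
  have h2 : T / (S * (1 + |x|)) ≤ 1 + |x - μ| / σ := by
    rw [div_le_iff₀ (by positivity)]
    have hu : |μ| ≤ |x - μ| + |x| := by
      have := abs_add_le (μ - x) x; rw [abs_sub_comm μ x] at this; simpa using this
    have h3 : |x - μ| ≤ |x - μ| / σ * S := by
      rw [div_mul_eq_mul_div, le_div_iff₀ hσ0]; gcongr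
    have h4 : 0 ≤ |x - μ| * |x| := by positivity
    calc T ≤ (1 + |x - μ|) * (1 + |x|) := by nlinarith
      _ ≤ (S + |x - μ| / σ * S) * (1 + |x|) := by gcongr
      _ = _ := by ring
  have h3 : (1 + |x - μ| / σ) ^ (-τ) ≤ S ^ τ * T ^ (-τ) * (1 + |x|) ^ τ := by
    refine (Real.rpow_le_rpow_of_nonpos (by positivity) h2 (by linarith)).trans_eq ?_
    rw [Real.div_rpow (by positivity) (by positivity), Real.mul_rpow (by positivity) (by positivity),
      Real.rpow_neg (by positivity : 0 ≤ S), Real.rpow_neg (by positivity : 0 ≤ 1 + |x|)]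
    field_simp
  calc _ ≤ (√s)⁻¹ * (A * (S ^ τ * T ^ (-τ) * (1 + |x|) ^ τ)) := by gcongr; exact h1.trans h3
    _ = _ := by ring

/-- Locations within `s` of `a` and scales in `[s / 2, s]` share one dominating function. -/
lemma RootTail.rootComp_le_near (h : RootTail f A τ) (hA : 0 ≤ A) (hτ : 0 ≤ τ) (m : Fin M)
    {μ σ s a : ℝ} (hs : 0 < s) (hσ : s / 2 ≤ σ) (hσs : σ ≤ s) (hμ : |μ - a| ≤ s) (x : ℝ) :
    rootComp f m μ σ x ≤ ENNReal.ofReal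
      ((√(s / 2))⁻¹ * (A * 2 ^ (1 + 2 * τ)) * (1 + |(x - a) / s|) ^ (-(1 + 2 * τ))) := by
  have hσ0 : 0 < σ := by linarith
  refine ENNReal.ofReal_le_ofReal ((h.sqrt_locScale_le m hσ0 x).trans ?_)
  have h2 : (1 + |(x - a) / s|) / 2 ≤ 1 + |x - μ| / σ := by
    rw [abs_div, abs_of_pos hs]
    have hu : |x - a| ≤ |x - μ| + s := by
      have := abs_add_le (x - μ) (μ - a); simp only [sub_add_sub_cancel] at this; linarith
    have h3 : |x - a| / s ≤ |x - μ| / σ + 1 := by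
      calc |x - a| / s ≤ (|x - μ| + s) / s := by gcongr
        _ = |x - μ| / s + 1 := by field_simp
        _ ≤ _ := by gcongr
    have : 0 ≤ |x - μ| / σ := by positivity
    linarith
  have h3 : (1 + |x - μ| / σ) ^ (-(1 + 2 * τ)) ≤
      2 ^ (1 + 2 * τ) * (1 + |(x - a) / s|) ^ (-(1 + 2 * τ)) := by
    refine (Real.rpow_le_rpow_of_nonpos (by positivity) h2 (by linarith)).trans_eq ?_
    rw [Real.div_rpow (by positivity) (by positivity),
      Real.rpow_neg (by norm_num : (0 : ℝ) ≤ 2), div_inv_eq_mul, mul_comm]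
  calc _ ≤ (√(s / 2))⁻¹ * (A * (2 ^ (1 + 2 * τ) * (1 + |(x - a) / s|) ^ (-(1 + 2 * τ)))) := by
        gcongr
    _ = _ := by ring

end Roots

/-! ### Covers of the degenerating components -/

lemma integrable_one_add_abs_rpow {r : ℝ} (hr : 1 < r) :
    Integrable fun x : ℝ => (1 + |x|) ^ (-r) := by
  have := integrable_one_add_norm (E := ℝ) (μ := volume) (r := r) (by simpa using hr)
  simpa only [Real.norm_eq_abs] using this

lemma lintegral_one_add_abs_rpow {r a s : ℝ} (hr : 1 < r) (hs : 0 < s) :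
    ∫⁻ x : ℝ, ENNReal.ofReal ((1 + |(x - a) / s|) ^ (-r)) =
      ENNReal.ofReal (s * ∫ x : ℝ, (1 + |x|) ^ (-r)) := by
  have hi := integrable_one_add_abs_rpow hr
  have hi' : Integrable fun x : ℝ => (1 + |(x - a) / s|) ^ (-r) :=
    (hi.comp_div hs.ne').comp_sub_right a
  rw [← ofReal_integral_eq_lintegral_ofReal hi' (ae_of_all _ fun x => by positivity)]
  rw [integral_sub_right_eq_self (fun x : ℝ => (1 + |x / s|) ^ (-r)) a,
    Measure.integral_comp_div (fun x : ℝ => (1 + |x|) ^ (-r)) s, abs_of_pos hs, smul_eq_mul]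

section Components

variable {M : ℕ} {f : Fin M → ℝ → ℝ} {A τ D : ℝ} {w : ℝ → ℝ≥0∞}

lemma lintegral_near_le (hτ : 0 < τ) (hD : 0 ≤ D)
    (hw : ∀ x, w x ≤ ENNReal.ofReal (D * (1 + |x|) ^ (-(1 + 2 * τ)))) {K a s : ℝ} (hK : 0 ≤ K)
    (hs : 0 < s) :
    ∫⁻ x, ENNReal.ofReal (K * (1 + |(x - a) / s|) ^ (-(1 + 2 * τ))) * w x ≤
      ENNReal.ofReal (K * D * (s * ∫ x : ℝ, (1 + |x|) ^ (-(1 + 2 * τ)))) := by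
  rw [ENNReal.ofReal_mul (by positivity), ← lintegral_one_add_abs_rpow (a := a) (by linarith) hs,
    ← lintegral_const_mul' _ _ ENNReal.ofReal_ne_top]
  refine lintegral_mono fun x => ?_
  have hwx : w x ≤ ENNReal.ofReal D := (hw x).trans <| ENNReal.ofReal_le_ofReal <|
    mul_le_of_le_one_right hD <| Real.rpow_le_one_of_one_le_of_nonpos
      (le_add_of_nonneg_right (abs_nonneg x)) (by linarith)
  calc _ ≤ ENNReal.ofReal (K * (1 + |(x - a) / s|) ^ (-(1 + 2 * τ))) * ENNReal.ofReal D := by gcongr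
    _ = _ := by
      rw [← ENNReal.ofReal_mul (by positivity), ← ENNReal.ofReal_mul (by positivity)]
      congr 1; ring

lemma lintegral_far_le (hτ : 0 < τ) (hD : 0 ≤ D)
    (hw : ∀ x, w x ≤ ENNReal.ofReal (D * (1 + |x|) ^ (-(1 + 2 * τ)))) {K : ℝ} (hK : 0 ≤ K) :
    ∫⁻ x, ENNReal.ofReal (K * (1 + |x|) ^ τ) * w x ≤
      ENNReal.ofReal (K * D * ∫ x : ℝ, (1 + |x|) ^ (-(1 + τ))) := by
  have h1 := lintegral_one_add_abs_rpow (r := 1 + τ) (a := 0) (s := 1) (by linarith) one_pos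
  simp only [sub_zero, div_one, one_mul] at h1
  rw [ENNReal.ofReal_mul (by positivity), ← h1, ← lintegral_const_mul' _ _ ENNReal.ofReal_ne_top]
  refine lintegral_mono fun x => ?_
  calc _ ≤ ENNReal.ofReal (K * (1 + |x|) ^ τ) *
        ENNReal.ofReal (D * (1 + |x|) ^ (-(1 + 2 * τ))) := by gcongr; exact hw x
    _ = _ := by
      rw [← ENNReal.ofReal_mul (by positivity), ← ENNReal.ofReal_mul (by positivity)]
      congr 1
      have : (1 + |x|) ^ (-(1 + τ)) = (1 + |x|) ^ τ * (1 + |x|) ^ (-(1 + 2 * τ)) := by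
        rw [← Real.rpow_add (by positivity)]; congr 1; ring
      rw [this]; ring

lemma measurable_near (K a s r : ℝ) :
    Measurable fun x : ℝ => ENNReal.ofReal (K * (1 + |(x - a) / s|) ^ (-r)) := by
  fun_prop

lemma measurable_far (K r : ℝ) :
    Measurable fun x : ℝ => ENNReal.ofReal (K * (1 + |x|) ^ r) := by
  fun_prop

/-- Components with scale between `s / 2` and `s`, where `s = 2 ^ (-j)`.  The locations in a range
of polynomial length in `s⁻¹` are covered by a grid of mesh `s`, the others by one function; every
covering function has affinity `O(√s)` with the truth. -/
lemma exists_upperCover_dyadic (h : RootTail f A τ) (hA : 0 ≤ A) (hτ : 0 < τ) (hD : 0 ≤ D)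
    (hw : ∀ x, w x ≤ ENNReal.ofReal (D * (1 + |x|) ^ (-(1 + 2 * τ)))) :
    ∃ C : ℝ, 0 ≤ C ∧ ∃ B : ℕ, 1 ≤ B ∧ ∀ j : ℕ,
      UpperCover w (ENNReal.ofReal (C * √((1 / 2) ^ j))) (4 * B ^ j)
        {g | ∃ m μ σ, (1 / 2 : ℝ) ^ (j + 1) ≤ σ ∧ σ ≤ (1 / 2) ^ j ∧ g = rootComp f m μ σ} := by
  obtain ⟨p, hp⟩ := exists_nat_ge (1 / τ)
  have hpτ : 1 ≤ p * τ := by rwa [div_le_iff₀ hτ] at hp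
  set I := ∫ x : ℝ, (1 + |x|) ^ (-(1 + 2 * τ)) with hI
  set I' := ∫ x : ℝ, (1 + |x|) ^ (-(1 + τ)) with hI'
  have hI0 : 0 ≤ I := integral_nonneg fun x => by positivity
  have hI'0 : 0 ≤ I' := integral_nonneg fun x => by positivity
  refine ⟨√2 * A * D * (2 ^ (1 + 2 * τ) * I + I'), by positivity, 2 ^ (p + 1),
    Nat.one_le_two_pow, fun j => ?_⟩
  set s : ℝ := (1 / 2) ^ j with hs
  have hs0 : 0 < s := by positivity
  have hs1 : s ≤ 1 := pow_le_one₀ (by norm_num) (by norm_num)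
  have hs2 : (1 / 2 : ℝ) ^ (j + 1) = s / 2 := by rw [pow_succ]; ring
  have hroot : (√(s / 2))⁻¹ * s = √2 * √s := by
    rw [Real.sqrt_div hs0.le, inv_div, div_mul_eq_mul_div, div_eq_iff (by positivity), mul_assoc,
      Real.mul_self_sqrt hs0.le]
  set L : ℤ := 2 ^ (j * (p + 1)) with hL
  set near : ℤ → ℝ → ℝ≥0∞ := fun k x => ENNReal.ofReal
      ((√(s / 2))⁻¹ * (A * 2 ^ (1 + 2 * τ)) * (1 + |(x - k * s) / s|) ^ (-(1 + 2 * τ))) with hnear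
  set T : ℝ := 2 ^ (j * p) with hT
  set far : ℝ → ℝ≥0∞ := fun x => ENNReal.ofReal
      ((√(s / 2))⁻¹ * A * 1 ^ τ * T ^ (-τ) * (1 + |x|) ^ τ) with hfar
  have hcn : ∀ k ∈ Finset.Icc (-L) L, UpperCover w
      (ENNReal.ofReal (√2 * A * D * (2 ^ (1 + 2 * τ) * I + I') * √s)) 1 {g | g ≤ near k} := by
    intro k _
    refine UpperCover.single (measurable_near _ _ _ _).aemeasurable ?_ fun g hg => hg
    refine (lintegral_near_le hτ hD hw (by positivity) hs0).trans (ENNReal.ofReal_le_ofReal ?_)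
    calc _ = (√(s / 2))⁻¹ * s * (A * D * (2 ^ (1 + 2 * τ) * I)) := by rw [← hI]; ring
      _ ≤ (√(s / 2))⁻¹ * s * (A * D * (2 ^ (1 + 2 * τ) * I + I')) := by gcongr; linarith
      _ = _ := by rw [hroot]; ring
  have hTs : T ^ (-τ) ≤ s := by
    have e1 : s = (2 ^ j : ℝ) ^ (-1 : ℝ) := by
      rw [Real.rpow_neg_one, hs, one_div, inv_pow]
    have e2 : T ^ (-τ) = (2 ^ j : ℝ) ^ (-(p * τ)) := by
      rw [hT, pow_mul, ← Real.rpow_natCast _ p, ← Real.rpow_mul (by positivity)]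
      congr 1; ring
    rw [e1, e2]
    exact Real.rpow_le_rpow_of_exponent_le (one_le_pow₀ (by norm_num)) (by linarith)
  have hcf : UpperCover w
      (ENNReal.ofReal (√2 * A * D * (2 ^ (1 + 2 * τ) * I + I') * √s)) 1 {g | g ≤ far} := by
    refine UpperCover.single (measurable_far _ _).aemeasurable ?_ fun g hg => hg
    refine (lintegral_far_le hτ hD hw (by positivity)).trans (ENNReal.ofReal_le_ofReal ?_)
    have h2 : 0 ≤ (2 : ℝ) ^ (1 + 2 * τ) * I := by positivity
    calc _ = (√(s / 2))⁻¹ * T ^ (-τ) * (A * D * I') := by rw [← hI', Real.one_rpow]; ring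
      _ ≤ (√(s / 2))⁻¹ * s * (A * D * (2 ^ (1 + 2 * τ) * I + I')) := by gcongr; linarith
      _ = _ := by rw [hroot]; ring
  refine ((UpperCover.biUnion _ hcn).union hcf).mono le_rfl ?_ ?_
  · rw [Finset.sum_const, smul_eq_mul, mul_one, Int.card_Icc, ← pow_mul, mul_comm (p + 1) j]
    have : (1 : ℤ) ≤ L := one_le_pow₀ (by norm_num)
    have e : ((2 ^ (j * (p + 1)) : ℕ) : ℤ) = L := by rw [hL]; push_cast; rfl
    omega
  · rintro g ⟨m, μ, σ, h1, h2, rfl⟩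
    rw [hs2] at h1
    refine ⟨_, ?_, le_rfl⟩
    rcases le_or_gt T (1 + |μ|) with hμ | hμ
    · refine Or.inr fun x => ?_
      exact h.rootComp_le_far hA hτ.le m (by positivity) h1 (h2.trans hs1) le_rfl
        (by positivity) hμ x
    · left
      have hk : |μ / s| ≤ L := by
        have e : (L : ℝ) = T / s := by
          rw [hL, hT, hs]; push_cast
          rw [one_div, inv_pow, div_inv_eq_mul, ← pow_add, Nat.mul_succ]
        rw [e, abs_div, abs_of_pos hs0]
        gcongr; linarith
      obtain ⟨hk1, hk2⟩ := abs_le.1 hk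
      refine Set.mem_biUnion (x := ⌊μ / s⌋) ?_ fun x => ?_
      · simp only [Finset.coe_Icc, Set.mem_Icc]
        refine ⟨Int.le_floor.2 (by push_cast; exact hk1), ?_⟩
        have := (Int.floor_le (μ / s)).trans hk2
        exact_mod_cast this
      · refine h.rootComp_le_near hA hτ.le m hs0 h1 h2 ?_ x
        have e1 := Int.floor_le (μ / s)
        have e2 := (Int.lt_floor_add_one (μ / s)).le
        rw [le_div_iff₀ hs0] at e1
        rw [div_le_iff₀ hs0] at e2
        rw [abs_le]; constructor <;> nlinarith

/-- Components with scales in `[2 ^ (-k), 2 ^ (-j)]`: the size of the cover is exponential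
in `k`, its affinity with the truth is controlled by `j`. -/
lemma exists_upperCover_small (h : RootTail f A τ) (hA : 0 ≤ A) (hτ : 0 < τ) (hD : 0 ≤ D)
    (hw : ∀ x, w x ≤ ENNReal.ofReal (D * (1 + |x|) ^ (-(1 + 2 * τ)))) :
    ∃ C : ℝ, 0 ≤ C ∧ ∃ K B : ℕ, 1 ≤ B ∧ ∀ j k : ℕ,
      UpperCover w (ENNReal.ofReal (C * √((1 / 2) ^ j))) (K * B ^ k)
        {g | ∃ m μ σ, (1 / 2 : ℝ) ^ k ≤ σ ∧ σ ≤ (1 / 2) ^ j ∧ g = rootComp f m μ σ} := by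
  obtain ⟨C, hC, B, hB, hcov⟩ := exists_upperCover_dyadic h hA hτ hD hw
  refine ⟨C, hC, 4, 2 * B, by omega, fun j k => ?_⟩
  have hi : ∀ i ∈ Finset.Icc j k, UpperCover w (ENNReal.ofReal (C * √((1 / 2) ^ j))) (4 * B ^ k)
      {g | ∃ m μ σ, (1 / 2 : ℝ) ^ (i + 1) ≤ σ ∧ σ ≤ (1 / 2) ^ i ∧ g = rootComp f m μ σ} := by
    intro i hi
    obtain ⟨h1, h2⟩ := Finset.mem_Icc.1 hi
    refine (hcov i).mono (ENNReal.ofReal_le_ofReal ?_) ?_ fun g hg => ⟨g, hg, le_rfl⟩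
    · have : (1 / 2 : ℝ) ^ i ≤ (1 / 2) ^ j := pow_le_pow_of_le_one (by norm_num) (by norm_num) h1
      gcongr
    · gcongr
  refine (UpperCover.biUnion _ hi).mono le_rfl ?_ ?_
  · rw [Finset.sum_const, smul_eq_mul, Nat.card_Icc, mul_pow]
    calc (k + 1 - j) * (4 * B ^ k) ≤ 2 ^ k * (4 * B ^ k) := by
          gcongr
          have := Nat.lt_two_pow_self (n := k)
          omega
      _ = _ := by ring
  · rintro g ⟨m, μ, σ, h1, h2, rfl⟩
    have hσ : 0 < σ := lt_of_lt_of_le (by positivity) h1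
    obtain ⟨i, hi1, hi2⟩ := exists_nat_pow_near_of_lt_one hσ
      (h2.trans (pow_le_one₀ (by norm_num) (by norm_num))) (by norm_num : (0 : ℝ) < 1 / 2)
      (by norm_num)
    refine ⟨_, ?_, le_rfl⟩
    rcases lt_or_ge i j with hij | hij
    · -- then `σ = 2 ^ (-j)`, because `2 ^ (-(i + 1)) < σ ≤ 2 ^ (-j)` is impossible
      have := pow_le_pow_of_le_one (by norm_num : (0 : ℝ) ≤ 1 / 2) (by norm_num)
        (Nat.succ_le_of_lt hij)
      exact absurd (hi1.trans_le h2) (not_lt.2 this)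
    · refine Set.mem_biUnion (x := i) ?_ ⟨m, μ, σ, hi1.le, hi2, rfl⟩
      simp only [Finset.coe_Icc, Set.mem_Icc]
      refine ⟨hij, ?_⟩
      exact (pow_le_pow_iff_right_of_lt_one₀ (by norm_num : (0:ℝ) < 1 / 2) (by norm_num)).1
        (h1.trans hi2)

/-- Components outside a large box of locations and scales, with scale at least `2 ^ (-k)`: their
affinity with the truth is small, and the size of the cover is exponential in `k`. -/
lemma exists_upperCover_outside (h : RootTail f A τ) (hA : 0 ≤ A) (hτ : 0 < τ) (hD : 0 ≤ D)
    (hw : ∀ x, w x ≤ ENNReal.ofReal (D * (1 + |x|) ^ (-(1 + 2 * τ)))) {η : ℝ} (hη : 0 < η)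
    (r₀ : ℝ) :
    ∃ r : ℝ, r₀ ≤ r ∧ ∃ K B : ℕ, 1 ≤ B ∧ ∀ k : ℕ, UpperCover w (ENNReal.ofReal η) (K * B ^ k)
      {g | ∃ m μ σ, (1 / 2 : ℝ) ^ k ≤ σ ∧ ¬ (|μ| ≤ r ∧ r⁻¹ ≤ σ ∧ σ ≤ r) ∧
        g = rootComp f m μ σ} := by
  obtain ⟨C, hC, K, B, hB, hsmall⟩ := exists_upperCover_small h hA hτ hD hw
  set I' := ∫ x : ℝ, (1 + |x|) ^ (-(1 + τ)) with hI'
  have hI'0 : 0 ≤ I' := integral_nonneg fun x => by positivity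
  -- a level below which scales count as small
  obtain ⟨j, hj⟩ : ∃ j : ℕ, C * √((1 / 2) ^ j) ≤ η := by
    have : Tendsto (fun j : ℕ => C * √((1 / 2 : ℝ) ^ j)) atTop (𝓝 (C * √0)) :=
      ((Real.continuous_sqrt.tendsto 0).comp
        (tendsto_pow_atTop_nhds_zero_of_lt_one (by norm_num) (by norm_num))).const_mul C
    rw [Real.sqrt_zero, mul_zero] at this
    exact ((this.eventually_lt_const hη).exists).imp fun _ h => h.le
  -- a level above which scales count as large
  obtain ⟨S, hS1, hS⟩ : ∃ S : ℝ, 1 ≤ S ∧ (√S)⁻¹ * A * D * I' ≤ η := by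
    have : Tendsto (fun S : ℝ => (√S)⁻¹ * A * D * I') atTop (𝓝 (0 * A * D * I')) :=
      (((tendsto_inv_atTop_zero.comp Real.tendsto_sqrt_atTop).mul_const A).mul_const D).mul_const I'
    simp only [zero_mul] at this
    obtain ⟨S, h1, h2⟩ := ((eventually_ge_atTop 1).and (this.eventually_lt_const hη)).exists
    exact ⟨S, h1, h2.le⟩
  set s : ℝ := (1 / 2) ^ j with hs
  have hs0 : 0 < s := by positivity
  -- a distance above which locations count as far
  obtain ⟨T, hT1, hT⟩ : ∃ T : ℝ, 1 ≤ T ∧ (√s)⁻¹ * A * S ^ τ * T ^ (-τ) * D * I' ≤ η := by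
    have : Tendsto (fun T : ℝ => (√s)⁻¹ * A * S ^ τ * T ^ (-τ) * D * I') atTop
        (𝓝 ((√s)⁻¹ * A * S ^ τ * 0 * D * I')) :=
      (((tendsto_rpow_neg_atTop hτ).const_mul _).mul_const D).mul_const I'
    simp only [mul_zero, zero_mul] at this
    obtain ⟨S, h1, h2⟩ := ((eventually_ge_atTop 1).and (this.eventually_lt_const hη)).exists
    exact ⟨S, h1, h2.le⟩
  set r := max r₀ (max s⁻¹ (max S T)) with hr
  have hr1 : s⁻¹ ≤ r := (le_max_left _ _).trans (le_max_right _ _)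
  have hr2 : S ≤ r := (le_max_left _ _).trans ((le_max_right _ _).trans (le_max_right _ _))
  have hr3 : T ≤ r := (le_max_right _ _).trans ((le_max_right _ _).trans (le_max_right _ _))
  refine ⟨r, le_max_left _ _, K + 2, B, hB, fun k => ?_⟩
  set large : ℝ → ℝ≥0∞ := fun x => ENNReal.ofReal ((√S)⁻¹ * A * (1 + |x|) ^ τ) with hlarge
  set far : ℝ → ℝ≥0∞ := fun x => ENNReal.ofReal
    ((√s)⁻¹ * A * S ^ τ * T ^ (-τ) * (1 + |x|) ^ τ) with hfar
  have hcl : UpperCover w (ENNReal.ofReal η) 1 {g | g ≤ large} := by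
    refine UpperCover.single (measurable_far _ _).aemeasurable ?_ fun g hg => hg
    exact (lintegral_far_le hτ hD hw (by positivity)).trans (ENNReal.ofReal_le_ofReal hS)
  have hcf : UpperCover w (ENNReal.ofReal η) 1 {g | g ≤ far} := by
    refine UpperCover.single (measurable_far _ _).aemeasurable ?_ fun g hg => hg
    exact (lintegral_far_le hτ hD hw (by positivity)).trans (ENNReal.ofReal_le_ofReal hT)
  refine (((hsmall j k).mono (ENNReal.ofReal_le_ofReal hj) le_rfl
    fun g hg => ⟨g, hg, le_rfl⟩).union (hcl.union hcf)).mono le_rfl ?_ ?_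
  · have : 1 ≤ B ^ k := Nat.one_le_pow _ _ hB
    nlinarith
  · rintro g ⟨m, μ, σ, h1, h2, rfl⟩
    refine ⟨_, ?_, le_rfl⟩
    rcases le_or_gt σ s with hσ | hσ
    · exact Or.inl ⟨m, μ, σ, h1, hσ, rfl⟩
    refine Or.inr ?_
    rcases le_or_gt S σ with hσS | hσS
    · refine Or.inl fun x => ?_
      refine (h.rootComp_le_const hA hτ.le m (by linarith) hσS x).trans ?_
      refine ENNReal.ofReal_le_ofReal (le_mul_of_one_le_right (by positivity) ?_)
      exact Real.one_le_rpow (le_add_of_nonneg_right (abs_nonneg x)) hτ.le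
    · refine Or.inr fun x => ?_
      have hμ : T ≤ 1 + |μ| := by
        by_contra hlt
        refine h2 ⟨by linarith, ?_, by linarith⟩
        exact (inv_le_of_inv_le₀ hs0 hr1).trans hσ.le
      exact h.rootComp_le_far hA hτ.le m hs0 hσ.le hσS.le hS1 (by linarith) hμ x

end Components

/-! ### Hellinger affinity of distinct densities -/

section Densities

variable {M : ℕ} {f : Fin M → ℝ → ℝ}

lemma isDensity_locScale {g : ℝ → ℝ} (hg : IsDensity g) (μ : ℝ) {σ : ℝ} (hσ : 0 < σ) :
    IsDensity (locScale g μ σ) := by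
  refine ⟨locScale_nonneg hg.nonneg hσ, ?_, ?_⟩
  · exact ((hg.integrable.comp_div hσ.ne').comp_sub_right μ).const_mul (1 / σ)
  · simp only [locScale]
    rw [integral_const_mul, integral_sub_right_eq_self (fun x => g (x / σ)) μ,
      Measure.integral_comp_div, hg.integral_eq_one, abs_of_pos hσ, smul_eq_mul, mul_one,
      one_div, inv_mul_cancel₀ hσ.ne']

lemma isDensity_mixture (hf : ∀ m, IsDensity (f m)) {θ : Param M} (hθ : θ ∈ paramSpace M) :
    IsDensity (mixture f θ) := by
  have h := fun m => isDensity_locScale (hf m) (loc θ m) (hθ.2.2 m)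
  refine ⟨fun x => Finset.sum_nonneg fun m _ => mul_nonneg (hθ.1 m) ((h m).nonneg x), ?_, ?_⟩
  · exact integrable_finsetSum _ fun m _ => (h m).integrable.const_mul _
  · simp only [mixture]
    rw [integral_finsetSum _ fun m _ => (h m).integrable.const_mul _]
    simp only [integral_const_mul, (h _).integral_eq_one, mul_one]
    exact hθ.2.1

lemma lintegral_sqrt_mul_sqrt_lt_one {g h : ℝ → ℝ} (hg : IsDensity g) (hh : IsDensity h)
    (hne : ¬ g =ᵐ[volume] h) :
    ∫⁻ x, ENNReal.ofReal √(g x) * ENNReal.ofReal √(h x) < 1 := by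
  have hid : ∀ x, (g x + h x) / 2 - √(g x) * √(h x) = (√(g x) - √(h x)) ^ 2 / 2 := by
    intro x
    nlinarith [Real.sq_sqrt (hg.nonneg x), Real.sq_sqrt (hh.nonneg x)]
  have hi : Integrable fun x => (g x + h x) / 2 := (hg.integrable.add hh.integrable).div_const 2
  have hp : Integrable fun x => √(g x) * √(h x) := by
    refine hi.mono' ?_ (ae_of_all _ fun x => ?_)
    · exact (hg.integrable.aemeasurable.sqrt.mul hh.integrable.aemeasurable.sqrt).aestronglyMeasurable
    · rw [Real.norm_of_nonneg (by positivity)]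
      nlinarith [hid x, sq_nonneg (√(g x) - √(h x))]
  have h1 : ∫ x, (g x + h x) / 2 = 1 := by
    rw [integral_div, integral_add hg.integrable hh.integrable, hg.integral_eq_one,
      hh.integral_eq_one]
    norm_num
  simp only [← ENNReal.ofReal_mul (Real.sqrt_nonneg _)]
  rw [← ofReal_integral_eq_lintegral_ofReal hp (ae_of_all _ fun x => by positivity),
    ENNReal.ofReal_lt_one]
  by_contra! hge
  have hz : ∫ x, (√(g x) - √(h x)) ^ 2 / 2 = 0 := by
    refine le_antisymm ?_ (integral_nonneg fun x => by positivity)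
    simp only [← hid]
    rw [integral_sub hi hp, h1]
    linarith
  rw [integral_eq_zero_iff_of_nonneg (fun x => by positivity)
    (by simp only [← hid]; exact hi.sub hp)] at hz
  refine hne (hz.mono fun x hx => ?_)
  have hx0 : (√(g x) - √(h x)) ^ 2 / 2 = 0 := hx
  have : √(g x) = √(h x) := by
    have := pow_eq_zero_iff (two_ne_zero) |>.1 (by linarith : (√(g x) - √(h x)) ^ 2 = 0)
    linarith
  rwa [Real.sqrt_inj (hg.nonneg x) (hh.nonneg x)] at this

/-- Parameters at distance at least `ε` from those equivalent to `θ₀`, together with the parameters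
that have a vanishing weight. -/
def awayParams (f : Fin M → ℝ → ℝ) (θ₀ : Param M) (ε : ℝ) : Set (Param M) :=
  {θ | θ ∈ paramSpace M ∧
    ((∀ θ' ∈ equivParams f θ₀, ε ≤ dist θ θ') ∨ ∃ m, weight θ m = 0)}

lemma not_ae_eq_of_mem_awayParams {θ₀ : Param M} {ε : ℝ} (hε : 0 < ε)
    (h_true : mixture f θ₀ ∉ mixtureClass f (M - 1)) {θ : Param M}
    (hθ : θ ∈ awayParams f θ₀ ε) : ¬ mixture f θ =ᵐ[volume] mixture f θ₀ := by
  intro heq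
  obtain ⟨hΘ, hfar | ⟨m, hm⟩⟩ := hθ
  · have := hfar θ ⟨hΘ, heq⟩
    rw [dist_self] at this
    linarith
  · refine h_true ⟨θ, hΘ, ?_, heq.symm⟩
    have hsub : {m : Fin M | weight θ m ≠ 0} ⊆ Set.univ \ {m} := by
      rintro i hi
      refine ⟨trivial, ?_⟩
      rintro rfl
      exact hi hm
    refine (Set.ncard_le_ncard hsub).trans ?_
    rw [Set.ncard_sdiff_singleton_of_mem (Set.mem_univ m), Set.ncard_univ, Nat.card_eq_fintype_card,
      Fintype.card_fin]

end Densities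

/-! ### Covers of the compact part of the parameter space -/

section Compact

variable {M : ℕ} {f : Fin M → ℝ → ℝ} {A τ D : ℝ} {w : ℝ → ℝ≥0∞}

/-- Parameters all of whose components have locations in `[-r, r]` and scales in `[r⁻¹, r]`. -/
def boxParams (M : ℕ) (r : ℝ) : Set (Param M) :=
  {θ | θ ∈ paramSpace M ∧ ∀ m, |loc θ m| ≤ r ∧ r⁻¹ ≤ scale θ m ∧ scale θ m ≤ r}

@[fun_prop]
lemma continuous_weight (m : Fin M) : Continuous fun θ : Param M => weight θ m := by
  unfold weight; fun_prop

@[fun_prop]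
lemma continuous_loc (m : Fin M) : Continuous fun θ : Param M => loc θ m := by
  unfold loc; fun_prop

@[fun_prop]
lemma continuous_scale (m : Fin M) : Continuous fun θ : Param M => scale θ m := by
  unfold scale; fun_prop

lemma isCompact_boxParams {r : ℝ} (hr : 0 < r) : IsCompact (boxParams M r) := by
  have hK : IsCompact ((WithLp.toLp 2 : (Fin 3 × Fin M → ℝ) → Param M) ''
      Set.pi Set.univ fun _ => Set.Icc (-(r + 1)) (r + 1)) :=
    (isCompact_univ_pi fun _ => isCompact_Icc).image (PiLp.continuous_toLp 2 _)
  refine hK.of_isClosed_subset ?_ ?_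
  · have e : boxParams M r = {θ | (∀ m, 0 ≤ weight θ m) ∧ ∑ m, weight θ m = 1 ∧
        ∀ m, |loc θ m| ≤ r ∧ r⁻¹ ≤ scale θ m ∧ scale θ m ≤ r} := by
      ext θ
      constructor
      · rintro ⟨⟨h1, h2, -⟩, h3⟩
        exact ⟨h1, h2, h3⟩
      · rintro ⟨h1, h2, h3⟩
        exact ⟨⟨h1, h2, fun m => (inv_pos.2 hr).trans_le (h3 m).2.1⟩, h3⟩
    rw [e]
    simp only [Set.ofPred_and, Set.ofPred_forall]
    refine (isClosed_iInter fun m => isClosed_le (by fun_prop) (by fun_prop)).inter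
      ((isClosed_eq (by fun_prop) (by fun_prop)).inter (isClosed_iInter fun m => ?_))
    exact (isClosed_le (by fun_prop) (by fun_prop)).inter
      ((isClosed_le (by fun_prop) (by fun_prop)).inter (isClosed_le (by fun_prop) (by fun_prop)))
  · rintro θ ⟨hθ, h⟩
    refine ⟨WithLp.ofLp θ, ?_, rfl⟩
    rintro ⟨i, m⟩ -
    have h0 := hθ.1 m
    have h1 := weight_le_one hθ m
    have h2 := abs_le.1 (h m).1
    have h3 := hθ.2.2 m
    have h4 := (h m).2.2
    simp only [weight, loc, scale] at h0 h1 h2 h3 h4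
    rw [Set.mem_Icc]
    fin_cases i
    · exact ⟨by simp; linarith, by simp; linarith⟩
    · exact ⟨by simp; linarith, by simp; linarith⟩
    · exact ⟨by simp; linarith, by simp; linarith⟩

lemma isCompact_awayParams_inter_boxParams {θ₀ : Param M} {ε r : ℝ} (hr : 0 < r) :
    IsCompact (awayParams f θ₀ ε ∩ boxParams M r) := by
  have e : awayParams f θ₀ ε ∩ boxParams M r =
      boxParams M r ∩ ((⋂ θ' ∈ equivParams f θ₀, {θ | ε ≤ dist θ θ'}) ∪
        ⋃ m, {θ | weight θ m = 0}) := by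
    ext θ
    simp only [awayParams, boxParams, Set.mem_inter_iff, Set.mem_ofPred_eq, Set.mem_union,
      Set.mem_iInter, Set.mem_iUnion]
    tauto
  rw [e]
  refine (isCompact_boxParams hr).inter_right (IsClosed.union ?_ ?_)
  · exact isClosed_biInter fun θ' _ => isClosed_le (by fun_prop) (by fun_prop)
  · exact isClosed_iUnion_of_finite fun m => isClosed_eq (by fun_prop) (by fun_prop)

lemma exists_mem_boxParams_of_near {θ : Param M} (hθ : θ ∈ paramSpace M) :
    ∃ r > 0, ∃ ρ > 0, ∀ θ' ∈ paramSpace M, dist θ' θ ≤ ρ → θ' ∈ boxParams M r := by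
  obtain ⟨r, hr0, hr⟩ : ∃ r > 0, ∀ m, |loc θ m| < r ∧ r⁻¹ < scale θ m ∧ scale θ m < r := by
    refine ((eventually_gt_atTop (0 : ℝ)).and (eventually_all.2 fun m => ?_)).exists
    exact (eventually_gt_atTop _).and
      ((tendsto_inv_atTop_zero.eventually_lt_const (hθ.2.2 m)).and (eventually_gt_atTop _))
  have hU : IsOpen {θ' : Param M | ∀ m, |loc θ' m| < r ∧ r⁻¹ < scale θ' m ∧ scale θ' m < r} := by
    simp only [Set.ofPred_and, Set.ofPred_forall]
    refine isOpen_iInter_of_finite fun m => ?_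
    exact (isOpen_lt (by fun_prop) (by fun_prop)).inter
      ((isOpen_lt (by fun_prop) (by fun_prop)).inter (isOpen_lt (by fun_prop) (by fun_prop)))
  obtain ⟨ε, hε, hball⟩ := Metric.isOpen_iff.1 hU θ hr
  refine ⟨r, hr0, ε / 2, by positivity, fun θ' hθ' hd => ⟨hθ', fun m => ?_⟩⟩
  have := hball (show θ' ∈ Metric.ball θ ε from lt_of_le_of_lt hd (by linarith)) m
  exact ⟨this.1.le, this.2.1.le, this.2.2.le⟩

lemma mixture_nonneg (hf : ∀ m x, 0 ≤ f m x) {θ : Param M} (hθ : θ ∈ paramSpace M) (x : ℝ) :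
    0 ≤ mixture f θ x :=
  Finset.sum_nonneg fun m _ => mul_nonneg (hθ.1 m) (locScale_nonneg (hf m) (hθ.2.2 m) x)

lemma rootMix_eq_rpow (hf : ∀ m x, 0 ≤ f m x) {θ : Param M} (hθ : θ ∈ paramSpace M) (x : ℝ) :
    rootMix f θ x = ENNReal.ofReal (mixture f θ x) ^ (1 / 2 : ℝ) := by
  rw [rootMix, Real.sqrt_eq_rpow,
    ENNReal.ofReal_rpow_of_nonneg (mixture_nonneg hf hθ x) (by norm_num)]

lemma rootMix_le_sum (hf : ∀ m x, 0 ≤ f m x) {θ : Param M} (hθ : θ ∈ paramSpace M) (x : ℝ) :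
    rootMix f θ x ≤ ∑ m, rootComp f m (loc θ m) (scale θ m) x := by
  refine (ofReal_sqrt_sum_le _ _ fun m _ => mul_nonneg (hθ.1 m)
    (locScale_nonneg (hf m) (hθ.2.2 m) x)).trans (Finset.sum_le_sum fun m _ => ?_)
  exact ENNReal.ofReal_le_ofReal (Real.sqrt_le_sqrt
    (mul_le_of_le_one_left (locScale_nonneg (hf m) (hθ.2.2 m) x) (weight_le_one hθ m)))

lemma RootTail.rootMix_le_const (h : RootTail f A τ) (hf : ∀ m x, 0 ≤ f m x) (hA : 0 ≤ A)
    (hτ : 0 ≤ τ) {r : ℝ} (hr : 0 < r) {θ : Param M} (hθ : θ ∈ boxParams M r) (x : ℝ) :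
    rootMix f θ x ≤ M * ENNReal.ofReal ((√r⁻¹)⁻¹ * A) := by
  refine (rootMix_le_sum hf hθ.1 x).trans ?_
  refine (Finset.sum_le_sum fun m _ =>
    h.rootComp_le_const hA hτ m (inv_pos.2 hr) (hθ.2 m).2.1 x).trans_eq ?_
  simp

/-- Continuity along sequences in a compact set is continuity within that set. -/
lemma ContinuousInParam.tendsto_nhdsWithin (h : ContinuousInParam f) {Γ : Set (Param M)}
    (hΓ : IsCompact Γ) (hΓ' : Γ ⊆ paramSpace M) {θ : Param M} (hθ : θ ∈ Γ) :
    ∀ᵐ x, Tendsto (fun θ' => mixture f θ' x) (𝓝[Γ] θ) (𝓝 (mixture f θ x)) := by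
  classical
  obtain ⟨N, hN, hs⟩ := h Γ hΓ hΓ' θ hθ
  refine (measure_eq_zero_iff_ae_notMem.1 hN).mono fun x hx => tendsto_of_seq_tendsto fun s hsθ => ?_
  obtain ⟨h1, h2⟩ := tendsto_nhdsWithin_iff.1 hsθ
  have heq : (fun j => if s j ∈ Γ then s j else θ) =ᶠ[atTop] s :=
    h2.mono fun j hj => if_pos hj
  have := hs (fun j => if s j ∈ Γ then s j else θ) (fun j => by
    split_ifs with hj <;> assumption) (h1.congr' heq.symm) x hx
  exact this.congr' (heq.mono fun j hj => by
    simp only at hj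
    simp only [Function.comp, hj])

/-- A small ball around a parameter has a single dominating function, whose affinity with the truth
is close to that of the centre. -/
lemma RootTail.exists_local_bracket (h : RootTail f A τ) (hf : ∀ m x, 0 ≤ f m x) (hA : 0 ≤ A)
    (hτ : 0 ≤ τ) (h_meas : SupIsMeasurable f) (h_cont : ContinuousInParam f)
    (hwm : AEMeasurable w volume) (hw : ∫⁻ x, w x ≠ ∞) {θ : Param M} (hθ : θ ∈ paramSpace M)
    {c : ℝ≥0∞} (hc : ∫⁻ x, rootMix f θ x * w x < c) :
    ∃ ρ > 0, ∃ q : ℝ → ℝ≥0∞, AEMeasurable q volume ∧ ∫⁻ x, q x * w x < c ∧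
      ∀ θ' ∈ paramSpace M, dist θ' θ ≤ ρ → rootMix f θ' ≤ q := by
  obtain ⟨r, hr, ρ₁, hρ₁, hbox⟩ := exists_mem_boxParams_of_near hθ
  have hθb : θ ∈ boxParams M r := hbox θ hθ (by simpa using hρ₁.le)
  have hΓ := isCompact_boxParams (M := M) hr
  have hΓ' : boxParams M r ⊆ paramSpace M := fun _ h => h.1
  obtain ⟨ρ₀, hρ₀, hm⟩ := h_meas _ hΓ hΓ' θ hθb
  set ρ : ℕ → ℝ := fun k => min ρ₀ ρ₁ / (k + 2) with hρ
  have hmin : 0 < min ρ₀ ρ₁ := lt_min hρ₀ hρ₁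
  have hρpos : ∀ k, 0 < ρ k := fun k => by positivity
  have hρlt : ∀ k, ρ k < min ρ₀ ρ₁ := fun k => by
    rw [hρ]
    exact div_lt_self hmin (by have : (0 : ℝ) ≤ k := Nat.cast_nonneg k; linarith)
  have hρlim : Tendsto ρ atTop (𝓝 0) := by
    refine Tendsto.div_atTop tendsto_const_nhds ?_
    exact tendsto_atTop_add_const_right _ _ tendsto_natCast_atTop_atTop
  set b : ℝ≥0∞ := M * ENNReal.ofReal ((√r⁻¹)⁻¹ * A) with hb
  have hbtop : b ≠ ∞ := ENNReal.mul_ne_top (ENNReal.natCast_ne_top M) ENNReal.ofReal_ne_top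
  set q : ℕ → ℝ → ℝ≥0∞ := fun k x => supMixture f θ (ρ k) x ^ (1 / 2 : ℝ) with hq
  have hqm : ∀ k, AEMeasurable (q k) volume := fun k =>
    (hm (ρ k) (hρpos k) ((hρlt k).trans_le (min_le_left _ _))).pow_const _
  have hle : ∀ k, ∀ θ' ∈ paramSpace M, dist θ' θ ≤ ρ k → rootMix f θ' ≤ q k := by
    intro k θ' hθ' hd x
    rw [rootMix_eq_rpow hf hθ', hq]
    refine ENNReal.rpow_le_rpow ?_ (by norm_num)
    exact le_iSup₂ (f := fun θ' (_ : θ' ∈ {θ' : Param M | θ' ∈ paramSpace M ∧ dist θ' θ ≤ ρ k}) =>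
      ENNReal.ofReal (mixture f θ' x)) θ' ⟨hθ', hd⟩
  have hqb : ∀ k x, q k x ≤ b := by
    intro k x
    have : supMixture f θ (ρ k) x ≤ b ^ (2 : ℝ) := by
      refine iSup₂_le fun θ' hθ' => ?_
      have hbx := h.rootMix_le_const hf hA hτ hr
        (hbox θ' hθ'.1 (hθ'.2.trans ((hρlt k).le.trans (min_le_right _ _)))) x
      have := ENNReal.rpow_le_rpow hbx (by norm_num : (0 : ℝ) ≤ 2)
      rwa [rootMix_eq_rpow hf hθ'.1, ← ENNReal.rpow_mul,
        show (1 / 2 : ℝ) * 2 = 1 by norm_num, ENNReal.rpow_one] at this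
    calc q k x ≤ (b ^ (2 : ℝ)) ^ (1 / 2 : ℝ) := ENNReal.rpow_le_rpow this (by norm_num)
      _ = b := by rw [← ENNReal.rpow_mul]; norm_num
  have hlim : ∀ᵐ x, Tendsto (fun k => q k x * w x) atTop (𝓝 (rootMix f θ x * w x)) := by
    filter_upwards [h_cont.tendsto_nhdsWithin hΓ hΓ' hθb, ae_lt_top' hwm hw] with x hx hwx
    refine ENNReal.Tendsto.mul_const ?_ (Or.inr hwx.ne)
    rw [rootMix_eq_rpow hf hθ]
    refine ((ENNReal.continuous_rpow_const (y := 1 / 2)).tendsto _).comp ?_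
    have hx' := (ENNReal.continuous_ofReal.tendsto _).comp hx
    refine tendsto_order.2 ⟨fun a ha => Eventually.of_forall fun k => ha.trans_le ?_, fun a ha => ?_⟩
    · exact le_iSup₂ (f := fun θ' (_ : θ' ∈ {θ' : Param M | θ' ∈ paramSpace M ∧ dist θ' θ ≤ ρ k}) =>
        ENNReal.ofReal (mixture f θ' x)) θ ⟨hθ, by simpa using (hρpos k).le⟩
    · obtain ⟨a', ha', haa'⟩ := exists_between ha
      obtain ⟨δ, hδ, hball⟩ := Metric.mem_nhdsWithin_iff.1 (hx'.eventually_lt_const ha')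
      filter_upwards [hρlim.eventually_lt_const hδ] with k hk
      refine lt_of_le_of_lt (iSup₂_le fun θ' hθ' => ?_) haa'
      exact (show ENNReal.ofReal (mixture f θ' x) < a' from hball ⟨lt_of_le_of_lt hθ'.2 hk,
        hbox θ' hθ'.1 (hθ'.2.trans ((hρlt k).le.trans (min_le_right _ _)))⟩).le
  have hint := tendsto_lintegral_of_dominated_convergence' (fun x => b * w x)
    (fun k => (hqm k).mul hwm) (fun k => ae_of_all _ fun x => mul_le_mul_left (hqb k x) (w x))
    (by rw [lintegral_const_mul' _ _ hbtop]; exact ENNReal.mul_ne_top hbtop hw) hlim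
  obtain ⟨k, hk⟩ := (hint.eventually_lt_const hc).exists
  exact ⟨ρ k, hρpos k, q k, hqm k, hk, hle k⟩

lemma RootTail.exists_upperCover_of_isCompact (h : RootTail f A τ) (hf : ∀ m x, 0 ≤ f m x)
    (hA : 0 ≤ A) (hτ : 0 ≤ τ) (h_meas : SupIsMeasurable f) (h_cont : ContinuousInParam f)
    (hwm : AEMeasurable w volume) (hw : ∫⁻ x, w x ≠ ∞) {C : Set (Param M)} (hC : IsCompact C)
    (hC' : C ⊆ paramSpace M) (haff : ∀ θ ∈ C, ∫⁻ x, rootMix f θ x * w x < 1) :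
    ∃ c < 1, ∃ N, UpperCover w c N (rootMix f '' C) := by
  have key : ∃ c < 1, ∃ N, UpperCover w c N (rootMix f '' (C ∩ paramSpace M)) := by
    refine hC.induction_on (p := fun s => ∃ c < 1, ∃ N, UpperCover w c N
      (rootMix f '' (s ∩ paramSpace M))) ?_ ?_ ?_ ?_
    · exact ⟨0, one_pos, 0, ∅, by simp⟩
    · rintro s t hst ⟨c, hc, N, hN⟩
      exact ⟨c, hc, N, hN.subset (Set.image_mono (Set.inter_subset_inter_left _ hst))⟩
    · rintro s t ⟨c, hc, N, hN⟩ ⟨c', hc', N', hN'⟩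
      refine ⟨max c c', max_lt hc hc', N + N', ?_⟩
      rw [Set.union_inter_distrib_right, Set.image_union]
      exact (hN.mono (le_max_left _ _) le_rfl fun g hg => ⟨g, hg, le_rfl⟩).union
        (hN'.mono (le_max_right _ _) le_rfl fun g hg => ⟨g, hg, le_rfl⟩)
    · intro θ hθ
      obtain ⟨ρ, hρ, q, hqm, hq, hle⟩ :=
        h.exists_local_bracket hf hA hτ h_meas h_cont hwm hw (hC' hθ) (haff θ hθ)
      refine ⟨Metric.closedBall θ ρ, mem_nhdsWithin_of_mem_nhds (Metric.closedBall_mem_nhds θ hρ),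
        _, hq, 1, UpperCover.single hqm le_rfl ?_⟩
      rintro g ⟨θ', ⟨hd, hθ'⟩, rfl⟩
      exact hle θ' hθ' hd
  rwa [Set.inter_eq_left.2 hC'] at key

end Compact

/-! ### Splitting off the degenerating components -/

section Splitting

variable {M : ℕ} {f : Fin M → ℝ → ℝ} {A τ D : ℝ} {w : ℝ → ℝ≥0∞}

/-- If some but not necessarily all components lie in a box, the weight of the others can be moved
to one of the former.  The resulting parameter lies in the box and, if any component was moved,
has a vanishing weight. -/
lemma exists_mem_boxParams_rootMix_le (hf : ∀ m x, 0 ≤ f m x) {θ₀ : Param M} {ε r : ℝ}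
    (hr : 1 ≤ r) {θ : Param M} (hθ : θ ∈ awayParams f θ₀ ε) (K : Finset (Fin M))
    (hK : ∀ m ∈ K, |loc θ m| ≤ r ∧ r⁻¹ ≤ scale θ m ∧ scale θ m ≤ r) (hne : K.Nonempty) :
    ∃ θ' ∈ awayParams f θ₀ ε ∩ boxParams M r, ∀ x, rootMix f θ x ≤
      rootMix f θ' x + ∑ m ∈ Kᶜ, rootComp f m (loc θ m) (scale θ m) x := by
  rcases eq_or_ne K Finset.univ with rfl | hKu
  · exact ⟨θ, ⟨hθ, hθ.1, fun m => hK m (Finset.mem_univ m)⟩, fun x => by simp⟩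
  obtain ⟨m₀, hm₀⟩ := hne
  obtain ⟨m₁, hm₁⟩ : ∃ m, m ∉ K := by
    by_contra! h
    exact hKu (Finset.eq_univ_iff_forall.2 h)
  have hΘ := hθ.1
  set R := ∑ m ∈ Kᶜ, weight θ m with hR
  have hR0 : 0 ≤ R := Finset.sum_nonneg fun m _ => hΘ.1 m
  set v : Fin 3 × Fin M → ℝ := fun p =>
    if p.2 ∈ K then θ p + (if p.1 = 0 ∧ p.2 = m₀ then R else 0)
    else if p.1 = 2 then 1 else 0 with hv
  set θ' : Param M := WithLp.toLp 2 v with hθ'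
  have hwt : ∀ m ∈ K, weight θ' m = weight θ m + if m = m₀ then R else 0 := by
    intro m hm; simp [weight, hθ', hv, hm]
  have hwt0 : ∀ m, m ∉ K → weight θ' m = 0 := by
    intro m hm; simp [weight, hθ', hv, hm]
  have hloc : ∀ m ∈ K, loc θ' m = loc θ m := by
    intro m hm; simp [loc, hθ', hv, hm]
  have hloc0 : ∀ m, m ∉ K → loc θ' m = 0 := by
    intro m hm; simp [loc, hθ', hv, hm]
  have hsc : ∀ m ∈ K, scale θ' m = scale θ m := by
    intro m hm; simp [scale, hθ', hv, hm]
  have hsc0 : ∀ m, m ∉ K → scale θ' m = 1 := by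
    intro m hm; simp [scale, hθ', hv, hm]
  have hwle : ∀ m ∈ K, weight θ m ≤ weight θ' m := by
    intro m hm
    rw [hwt m hm]
    split_ifs <;> linarith
  have hΘ' : θ' ∈ paramSpace M := by
    refine ⟨fun m => ?_, ?_, fun m => ?_⟩
    · by_cases hm : m ∈ K
      · exact (hΘ.1 m).trans (hwle m hm)
      · exact (hwt0 m hm).ge
    · rw [← Finset.sum_add_sum_compl K, Finset.sum_congr rfl hwt,
        Finset.sum_eq_zero (s := Kᶜ) fun m hm => hwt0 m (Finset.mem_compl.1 hm),
        Finset.sum_add_distrib, Finset.sum_ite_eq' K m₀, if_pos hm₀, add_zero, hR,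
        Finset.sum_add_sum_compl]
      exact hΘ.2.1
    · by_cases hm : m ∈ K
      · rw [hsc m hm]; exact hΘ.2.2 m
      · rw [hsc0 m hm]; exact one_pos
  refine ⟨θ', ⟨⟨hΘ', Or.inr ⟨m₁, hwt0 m₁ hm₁⟩⟩, hΘ', fun m => ?_⟩, fun x => ?_⟩
  · by_cases hm : m ∈ K
    · rw [hloc m hm, hsc m hm]; exact hK m hm
    · rw [hloc0 m hm, hsc0 m hm, abs_zero]
      exact ⟨by linarith, inv_le_one_of_one_le₀ hr, hr⟩
  · have hnn : ∀ m, 0 ≤ locScale (f m) (loc θ m) (scale θ m) x :=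
      fun m => locScale_nonneg (hf m) (hΘ.2.2 m) x
    have hnn' : ∀ m, 0 ≤ locScale (f m) (loc θ' m) (scale θ' m) x :=
      fun m => locScale_nonneg (hf m) (hΘ'.2.2 m) x
    have h1 : mixture f θ x ≤ mixture f θ' x +
        ∑ m ∈ Kᶜ, locScale (f m) (loc θ m) (scale θ m) x := by
      rw [mixture, ← Finset.sum_add_sum_compl K]
      refine add_le_add ?_ (Finset.sum_le_sum fun m _ =>
        mul_le_of_le_one_left (hnn m) (weight_le_one hΘ m))
      calc _ ≤ ∑ m ∈ K, weight θ' m * locScale (f m) (loc θ' m) (scale θ' m) x := by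
            refine Finset.sum_le_sum fun m hm => ?_
            rw [hloc m hm, hsc m hm]
            exact mul_le_mul_of_nonneg_right (hwle m hm) (hnn m)
        _ ≤ _ := Finset.sum_le_univ_sum_of_nonneg fun m => mul_nonneg (hΘ'.1 m) (hnn' m)
    calc rootMix f θ x ≤ ENNReal.ofReal (√(mixture f θ' x) +
          √(∑ m ∈ Kᶜ, locScale (f m) (loc θ m) (scale θ m) x)) :=
        ENNReal.ofReal_le_ofReal ((Real.sqrt_le_sqrt h1).trans (sqrt_add_le_add_sqrt _ _
          (mixture_nonneg hf hΘ' x) (Finset.sum_nonneg fun m _ => hnn m)))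
      _ ≤ _ := by
        rw [ENNReal.ofReal_add (Real.sqrt_nonneg _) (Real.sqrt_nonneg _)]
        exact add_le_add le_rfl (ofReal_sqrt_sum_le _ _ fun m _ => hnn m)

/-- Parameters all of whose scales are small. -/
lemma exists_upperCover_all_small (h : RootTail f A τ) (hf : ∀ m x, 0 ≤ f m x) (hA : 0 ≤ A)
    (hτ : 0 < τ) (hD : 0 ≤ D) (hwm : AEMeasurable w volume)
    (hw : ∀ x, w x ≤ ENNReal.ofReal (D * (1 + |x|) ^ (-(1 + 2 * τ)))) :
    ∃ C : ℝ, 0 ≤ C ∧ ∃ K B : ℕ, 1 ≤ B ∧ ∀ j k : ℕ,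
      UpperCover w (ENNReal.ofReal (C * √((1 / 2) ^ j))) (K * B ^ k)
        {g | ∃ θ ∈ paramSpace M, (∀ m, (1 / 2 : ℝ) ^ k ≤ scale θ m ∧ scale θ m ≤ (1 / 2) ^ j) ∧
          g = rootMix f θ} := by
  obtain ⟨C, hC, K, B, hB, hcov⟩ := exists_upperCover_small h hA hτ hD hw
  refine ⟨M * C, by positivity, K ^ M, B ^ M, Nat.one_le_pow _ _ hB, fun j k => ?_⟩
  refine ((hcov j k).sum hwm (Finset.univ : Finset (Fin M))).mono ?_ ?_ ?_
  · rw [Finset.card_univ, Fintype.card_fin, mul_assoc, ← ENNReal.ofReal_natCast M,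
      ← ENNReal.ofReal_mul (by positivity)]
  · rw [Finset.card_univ, Fintype.card_fin, mul_pow, ← pow_mul, ← pow_mul, mul_comm k M]
  · rintro g ⟨θ, hθ, hsc, rfl⟩
    refine ⟨_, ⟨fun m => rootComp f m (loc θ m) (scale θ m),
      fun m _ => ⟨m, _, _, (hsc m).1, (hsc m).2, rfl⟩, rfl⟩, fun x => ?_⟩
    rw [Finset.sum_apply]
    exact rootMix_le_sum hf hθ x

/-- Parameters each of whose components either lies in the box of size `r` or outside the much
larger box of size `r'`. -/
lemma exists_upperCover_gap (h : RootTail f A τ) (hf : ∀ m x, 0 ≤ f m x) (hA : 0 ≤ A)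
    (hτ : 0 < τ) (hD : 0 ≤ D) (hwm : AEMeasurable w volume)
    (hw : ∀ x, w x ≤ ENNReal.ofReal (D * (1 + |x|) ^ (-(1 + 2 * τ)))) (hwt : ∫⁻ x, w x ≠ ∞)
    (h_meas : SupIsMeasurable f) (h_cont : ContinuousInParam f) {θ₀ : Param M} {ε : ℝ}
    (haff : ∀ θ ∈ awayParams f θ₀ ε, ∫⁻ x, rootMix f θ x * w x < 1) (r : ℝ) (hr : 1 ≤ r) :
    ∃ r' : ℝ, r ≤ r' ∧ ∃ c < 1, ∃ K B : ℕ, 1 ≤ B ∧ ∀ k : ℕ, UpperCover w c (K * B ^ k)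
      {g | ∃ θ ∈ awayParams f θ₀ ε, (∀ m, (1 / 2 : ℝ) ^ k ≤ scale θ m) ∧
        (∀ m, (|loc θ m| ≤ r ∧ r⁻¹ ≤ scale θ m ∧ scale θ m ≤ r) ∨
          ¬ (|loc θ m| ≤ r' ∧ r'⁻¹ ≤ scale θ m ∧ scale θ m ≤ r')) ∧ g = rootMix f θ} := by
  classical
  obtain ⟨c, hc, N, hreg⟩ := h.exists_upperCover_of_isCompact hf hA hτ.le h_meas h_cont hwm hwt
    (isCompact_awayParams_inter_boxParams (f := f) (θ₀ := θ₀) (ε := ε) (by linarith : 0 < r))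
    (fun θ hθ => hθ.1.1) (fun θ hθ => haff θ hθ.1)
  have hctop : c ≠ ∞ := (hc.trans ENNReal.one_lt_top).ne
  have hc1 : c.toReal < 1 := by
    have := (ENNReal.toReal_lt_toReal hctop ENNReal.one_ne_top).2 hc
    simpa using this
  -- the affinity allowed to each degenerate component
  set η : ℝ := (1 - c.toReal) / (M + 1) with hη
  have hη0 : 0 < η := div_pos (by linarith) (by positivity)
  have hlt : c + M * ENNReal.ofReal η < 1 := by
    rw [← ENNReal.ofReal_toReal hctop, ← ENNReal.ofReal_natCast M,
      ← ENNReal.ofReal_mul (by positivity), ← ENNReal.ofReal_add (by positivity) (by positivity),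
      ENNReal.ofReal_lt_one]
    have : (M : ℝ) * η + η = 1 - c.toReal := by rw [hη]; field_simp
    linarith
  obtain ⟨r', hr', K, B, hB, hout⟩ := exists_upperCover_outside h hA hτ hD hw hη0 r
  refine ⟨r', hr', _, hlt, (N + 1) * (K + 1) ^ M, B ^ M, Nat.one_le_pow _ _ hB, fun k => ?_⟩
  have hzero : ∀ c', UpperCover w c' 1 ({0} : Set (ℝ → ℝ≥0∞)) := fun c' =>
    UpperCover.single (q := 0) aemeasurable_const (by simp) (by simp)
  refine ((hreg.union (hzero c)).add hwm
    (((hout k).union (hzero _)).sum hwm (Finset.univ : Finset (Fin M)))).mono ?_ ?_ ?_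
  · rw [Finset.card_univ, Fintype.card_fin]
  · rw [Finset.card_univ, Fintype.card_fin, mul_assoc, ← pow_mul, mul_comm M k, pow_mul, ← mul_pow]
    gcongr
    have : 1 ≤ B ^ k := Nat.one_le_pow _ _ hB
    nlinarith
  · rintro g ⟨θ, hθ, hsc, hgap, rfl⟩
    set S : Finset (Fin M) := Finset.univ.filter fun m =>
      |loc θ m| ≤ r ∧ r⁻¹ ≤ scale θ m ∧ scale θ m ≤ r with hS
    set u : Fin M → ℝ → ℝ≥0∞ := fun m =>
      if m ∈ S then 0 else rootComp f m (loc θ m) (scale θ m) with hu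
    have hsum : ∀ x, (∑ m, u m) x = ∑ m ∈ Sᶜ, rootComp f m (loc θ m) (scale θ m) x := by
      intro x
      rw [← Finset.sum_add_sum_compl S, Finset.sum_eq_zero (s := S) fun m hm => if_pos hm,
        zero_add, Finset.sum_apply]
      exact Finset.sum_congr rfl fun m hm => by rw [hu]; simp only [if_neg (Finset.mem_compl.1 hm)]
    have hu' : ∀ m, u m ∈ {g | ∃ m μ σ, (1 / 2 : ℝ) ^ k ≤ σ ∧
        ¬ (|μ| ≤ r' ∧ r'⁻¹ ≤ σ ∧ σ ≤ r') ∧ g = rootComp f m μ σ} ∪ {0} := by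
      intro m
      by_cases hm : m ∈ S
      · right; simp [hu, hm]
      · left
        refine ⟨m, loc θ m, scale θ m, hsc m, (hgap m).resolve_left fun hb => hm ?_, if_neg hm⟩
        simpa [hS] using hb
    rcases S.eq_empty_or_nonempty with hSe | hSne
    · refine ⟨_, ⟨0, Or.inr rfl, ∑ m, u m, ⟨u, fun m _ => hu' m, rfl⟩, rfl⟩, fun x => ?_⟩
      rw [zero_add, hsum, hSe, Finset.compl_empty]
      exact rootMix_le_sum hf hθ.1 x
    · obtain ⟨θ', hθ', hle⟩ := exists_mem_boxParams_rootMix_le hf hr hθ S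
        (fun m hm => (Finset.mem_filter.1 hm).2) hSne
      refine ⟨_, ⟨rootMix f θ', Or.inl ⟨θ', hθ', rfl⟩, ∑ m, u m, ⟨u, fun m _ => hu' m, rfl⟩, rfl⟩,
        fun x => ?_⟩
      rw [Pi.add_apply, hsum]
      exact hle x

lemma UpperCover.exists_biUnion_range {F : ℕ → ℕ → Set (ℝ → ℝ≥0∞)}
    (h : ∀ i, ∃ c < 1, ∃ K B : ℕ, 1 ≤ B ∧ ∀ k, UpperCover w c (K * B ^ k) (F i k)) (n : ℕ) :
    ∃ c < 1, ∃ K B : ℕ, 1 ≤ B ∧ ∀ k, UpperCover w c (K * B ^ k) (⋃ i ∈ Finset.range n, F i k) := by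
  induction n with
  | zero => exact ⟨0, one_pos, 0, 1, le_rfl, fun k => ⟨∅, by simp⟩⟩
  | succ n ih =>
    obtain ⟨c, hc, K, B, hB, hcov⟩ := ih
    obtain ⟨c', hc', K', B', hB', hcov'⟩ := h n
    refine ⟨max c c', max_lt hc hc', K' + K, B' * B, Nat.mul_pos hB' hB, fun k => ?_⟩
    rw [Finset.range_add_one, Finset.set_biUnion_insert]
    refine (((hcov' k).mono (le_max_right _ _) le_rfl fun g hg => ⟨g, hg, le_rfl⟩).union
      ((hcov k).mono (le_max_left _ _) le_rfl fun g hg => ⟨g, hg, le_rfl⟩)).mono le_rfl ?_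
      fun g hg => ⟨g, hg, le_rfl⟩
    have h1 : 1 ≤ B ^ k := Nat.one_le_pow _ _ hB
    have h2 : 1 ≤ B' ^ k := Nat.one_le_pow _ _ hB'
    rw [mul_pow, add_mul]
    gcongr
    · exact Nat.le_mul_of_pos_right _ h1
    · exact Nat.le_mul_of_pos_left _ h2

/-- All parameters away from the truth whose scales are at least `2 ^ (-k)`: the affinity of the
covering functions with the truth is bounded away from `1`, and their number is exponential in `k`.
Among `M + 1` nested boxes there is a consecutive pair with none of the `M` components between
them. -/
lemma exists_upperCover_awayParams (h : RootTail f A τ) (hf : ∀ m x, 0 ≤ f m x) (hA : 0 ≤ A)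
    (hτ : 0 < τ) (hD : 0 ≤ D) (hwm : AEMeasurable w volume)
    (hw : ∀ x, w x ≤ ENNReal.ofReal (D * (1 + |x|) ^ (-(1 + 2 * τ)))) (hwt : ∫⁻ x, w x ≠ ∞)
    (h_meas : SupIsMeasurable f) (h_cont : ContinuousInParam f) {θ₀ : Param M} {ε : ℝ}
    (haff : ∀ θ ∈ awayParams f θ₀ ε, ∫⁻ x, rootMix f θ x * w x < 1) :
    ∃ c < 1, ∃ K B : ℕ, 1 ≤ B ∧ ∀ k : ℕ, UpperCover w c (K * B ^ k)
      {g | ∃ θ ∈ awayParams f θ₀ ε, (∀ m, (1 / 2 : ℝ) ^ k ≤ scale θ m) ∧ g = rootMix f θ} := by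
  have hgap := exists_upperCover_gap h hf hA hτ hD hwm hw hwt h_meas h_cont haff
  choose! next hnext hcov using hgap
  set ρ : ℕ → ℝ := fun i => next^[i] 1 with hρ
  have hρs : ∀ i, ρ (i + 1) = next (ρ i) := fun i => Function.iterate_succ_apply' next i 1
  have hρ1 : ∀ i, 1 ≤ ρ i := by
    intro i
    induction i with
    | zero => exact le_rfl
    | succ i ih => rw [hρs]; exact ih.trans (hnext _ ih)
  have hmono : Monotone ρ := monotone_nat_of_le_succ fun i => by rw [hρs]; exact hnext _ (hρ1 i)
  obtain ⟨c, hc, K, B, hB, hall⟩ := UpperCover.exists_biUnion_range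
    (fun i => hcov (ρ i) (hρ1 i)) (M + 1)
  refine ⟨c, hc, K, B, hB, fun k => (hall k).subset ?_⟩
  rintro g ⟨θ, hθ, hsc, rfl⟩
  suffices ∃ i ∈ Finset.range (M + 1), ∀ m,
      (|loc θ m| ≤ ρ i ∧ (ρ i)⁻¹ ≤ scale θ m ∧ scale θ m ≤ ρ i) ∨
        ¬ (|loc θ m| ≤ ρ (i + 1) ∧ (ρ (i + 1))⁻¹ ≤ scale θ m ∧ scale θ m ≤ ρ (i + 1)) by
    obtain ⟨i, hi, hm⟩ := this
    simp only [hρs] at hm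
    exact Set.mem_biUnion hi ⟨θ, hθ, hsc, hm, rfl⟩
  by_contra! hcon
  have : Nonempty (Fin M) := (hcon 0 (by simp)).nonempty
  choose! mm hmm using hcon
  obtain ⟨i, hi, j, hj, hij, heq⟩ := Finset.exists_ne_map_eq_of_card_lt_of_maps_to
    (s := Finset.range (M + 1)) (t := (Finset.univ : Finset (Fin M))) (f := mm) (by simp)
    (fun i _ => Finset.mem_univ _)
  wlog hlt : i < j generalizing i j
  · exact this j hj i hi hij.symm heq.symm (lt_of_le_of_ne (not_lt.1 hlt) hij.symm)
  obtain ⟨-, h1, h2, h3⟩ := hmm i hi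
  obtain ⟨h4, -⟩ := hmm j hj
  rw [← heq] at h4
  have hle : ρ (i + 1) ≤ ρ j := hmono hlt
  have hpos : 0 < ρ (i + 1) := one_pos.trans_le (hρ1 _)
  have h5 : (ρ j)⁻¹ ≤ (ρ (i + 1))⁻¹ := by gcongr
  have := h4 (h1.trans hle) (h5.trans h2)
  linarith

end Splitting

/-! ### Borel–Cantelli for subexponential scale constraints -/

section BorelCantelli

/-- An exponential in `k n = o(n)` does not spoil geometric convergence. -/
lemma summable_mul_pow_mul_pow {k : ℕ → ℕ}
    (hk : Tendsto (fun n => (k n : ℝ) / n) atTop (𝓝 0)) (K : ℝ) {B a : ℝ} (hB : 1 ≤ B)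
    (ha : 0 < a) (ha1 : a < 1) : Summable fun n => K * B ^ k n * a ^ n := by
  have hla : Real.log a < 0 := Real.log_neg ha ha1
  simp only [mul_assoc]
  refine Summable.mul_left K ?_
  have hr : Real.exp (Real.log a / 2) < 1 := by rw [Real.exp_lt_one_iff]; linarith
  refine Summable.of_norm_bounded_eventually_nat
    (summable_geometric_of_lt_one (Real.exp_pos _).le hr) ?_
  have hlim : Tendsto (fun n => (k n : ℝ) / n * Real.log B) atTop (𝓝 (0 * Real.log B)) :=
    hk.mul_const _
  rw [zero_mul] at hlim
  filter_upwards [hlim.eventually_lt_const (by linarith : 0 < -(Real.log a / 2)),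
    eventually_gt_atTop 0] with n hn hn0
  have hn0' : (0 : ℝ) < n := by exact_mod_cast hn0
  have hB0 : 0 < B := by linarith
  rw [div_mul_eq_mul_div, div_lt_iff₀ hn0'] at hn
  rw [Real.norm_of_nonneg (by positivity), ← Real.exp_log hB0, ← Real.exp_nat_mul]
  conv_lhs => rw [← Real.exp_log ha, ← Real.exp_nat_mul, ← Real.exp_add]
  rw [← Real.exp_nat_mul, Real.exp_le_exp]
  linarith

variable {Ω : Type*} [MeasurableSpace Ω] {P : Measure Ω} {X : ℕ → Ω → ℝ} {f₀ : ℝ → ℝ}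

lemma ae_eventually_notMem_of_le {E : ℕ → Set Ω} {u : ℕ → ℝ} (hu : Summable u)
    (h : ∀ᶠ n in atTop, P (E n) ≤ ENNReal.ofReal (u n)) : ∀ᵐ ω ∂P, ∀ᶠ n in atTop, ω ∉ E n := by
  obtain ⟨n₁, hn₁⟩ := eventually_atTop.1 h
  have hs : ∑' n, P (E (n + n₁)) ≠ ∞ :=
    ne_top_of_le_ne_top ((summable_nat_add_iff n₁).2 hu).tsum_ofReal_ne_top
      (ENNReal.tsum_le_tsum fun n => hn₁ (n + n₁) (by omega))
  filter_upwards [ae_eventually_notMem hs] with ω hω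
  obtain ⟨n₂, hn₂⟩ := eventually_atTop.1 hω
  refine eventually_atTop.2 ⟨n₁ + n₂, fun n hn => ?_⟩
  have := hn₂ (n - n₁) (by omega)
  rwa [Nat.sub_add_cancel (by omega)] at this

lemma ae_eventually_notMem_exceedSet (hX : IsIIDSample P X f₀) (hf₀ : AEMeasurable f₀ volume)
    {c : ℝ≥0∞} (hc : c < 1) {K B : ℕ} (hB : 1 ≤ B) {F : ℕ → Set (ℝ → ℝ≥0∞)}
    (hcov : ∀ k, UpperCover (fun x => ENNReal.ofReal √(f₀ x)) c (K * B ^ k) (F k)) {k : ℕ → ℕ}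
    (hk : Tendsto (fun n => (k n : ℝ) / n) atTop (𝓝 0)) (j : ℕ) :
    ∀ᵐ ω ∂P, ∀ᶠ n in atTop, ω ∉ exceedSet X f₀ n (F (k n + j)) := by
  have hctop : c ≠ ∞ := (hc.trans ENNReal.one_lt_top).ne
  have hc1 : c.toReal < 1 := by
    simpa using (ENNReal.toReal_lt_toReal hctop ENNReal.one_ne_top).2 hc
  have ha1 : max c.toReal (1 / 2) < 1 := max_lt hc1 (by norm_num)
  refine ae_eventually_notMem_of_le (summable_mul_pow_mul_pow hk (K * (B : ℝ) ^ j)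
    (B := B) (by exact_mod_cast hB) (a := max c.toReal (1 / 2))
    (lt_max_of_lt_right (by norm_num)) ha1) (Eventually.of_forall fun n => ?_)
  refine ((hcov (k n + j)).measure_exceedSet_le hX hf₀ n).trans ?_
  rw [ENNReal.ofReal_mul (by positivity), ENNReal.ofReal_pow (le_max_of_le_left (by positivity))]
  refine mul_le_mul' ?_ (pow_le_pow_left' ?_ n)
  · rw [← ENNReal.ofReal_natCast]
    refine ENNReal.ofReal_le_ofReal (le_of_eq ?_)
    push_cast
    ring
  · exact (ENNReal.ofReal_toReal hctop).ge.trans (ENNReal.ofReal_le_ofReal (le_max_left _ _))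

/-- Covers whose affinity with the truth decays geometrically in `j` are exceeded for none of the
large `j`, eventually, even if their sizes grow exponentially in `j`. -/
lemma exists_ae_eventually_notMem_exceedSet (hX : IsIIDSample P X f₀)
    (hf₀ : AEMeasurable f₀ volume) {C : ℝ} (hC : 0 ≤ C) {K B : ℕ} (hB : 1 ≤ B)
    {F : ℕ → ℕ → Set (ℝ → ℝ≥0∞)}
    (hcov : ∀ j k, UpperCover (fun x => ENNReal.ofReal √(f₀ x))
      (ENNReal.ofReal (C * √((1 / 2) ^ j))) (K * B ^ k) (F j k)) {k : ℕ → ℕ}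
    (hk : Tendsto (fun n => (k n : ℝ) / n) atTop (𝓝 0)) :
    ∃ j₀, ∀ᵐ ω ∂P, ∀ᶠ n in atTop, ∀ j, j₀ ≤ j → ω ∉ exceedSet X f₀ n (F j (k n + (j + 1))) := by
  set a : ℝ := √√(1 / 2) with ha
  have ha0 : 0 < a := by positivity
  have haa : a * a = √(1 / 2) := Real.mul_self_sqrt (by positivity)
  have ha1 : a < 1 := by
    have h1 : √(1 / 2 : ℝ) < 1 := by rw [Real.sqrt_lt' one_pos]; norm_num
    rw [ha, Real.sqrt_lt' one_pos]; simpa using h1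
  have hsq : ∀ j : ℕ, √((1 / 2 : ℝ) ^ j) = a ^ j * a ^ j := by
    intro j
    rw [← mul_pow, haa, Real.sqrt_eq_iff_mul_self_eq_of_pos (by positivity), ← mul_pow,
      Real.mul_self_sqrt (by norm_num)]
  obtain ⟨j₁, hj₁⟩ : ∃ j₁ : ℕ, C * a ^ j₁ ≤ 1 := by
    have := (tendsto_pow_atTop_nhds_zero_of_lt_one ha0.le ha1).const_mul C
    rw [mul_zero] at this
    exact (this.eventually_lt_const one_pos).exists.imp fun _ h => h.le
  have hBa : ∀ᶠ n : ℕ in atTop, (B : ℝ) * a ^ n ≤ 1 / 2 := by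
    have := (tendsto_pow_atTop_nhds_zero_of_lt_one ha0.le ha1).const_mul (B : ℝ)
    rw [mul_zero] at this
    exact (this.eventually_lt_const (by norm_num : (0 : ℝ) < 1 / 2)).mono fun _ h => h.le
  refine ⟨j₁ + 1, ?_⟩
  have hE : ∀ᵐ ω ∂P, ∀ᶠ n in atTop,
      ω ∉ ⋃ i, exceedSet X f₀ n (F (j₁ + 1 + i) (k n + (j₁ + 1 + i + 1))) := by
    refine ae_eventually_notMem_of_le (summable_mul_pow_mul_pow hk (2 * K * (B : ℝ) ^ 2)
      (B := B) (by exact_mod_cast hB) ha0 ha1) (hBa.mono fun n hn => ?_)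
    set x : ℝ := B * a ^ n with hx
    have hx0 : 0 ≤ x := by positivity
    have hterm : ∀ i, P (exceedSet X f₀ n (F (j₁ + 1 + i) (k n + (j₁ + 1 + i + 1)))) ≤
        ENNReal.ofReal (K * B ^ (k n + 1) * x * (1 / 2) ^ i) := by
      intro i
      refine ((hcov _ _).measure_exceedSet_le hX hf₀ n).trans ?_
      rw [← ENNReal.ofReal_natCast, ← ENNReal.ofReal_pow (by positivity),
        ← ENNReal.ofReal_mul (by positivity)]
      refine ENNReal.ofReal_le_ofReal ?_
      push_cast
      have h1 : C * √((1 / 2 : ℝ) ^ (j₁ + 1 + i)) ≤ a ^ (j₁ + 1 + i) := by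
        rw [hsq, ← mul_assoc]
        refine mul_le_of_le_one_left (by positivity) (le_trans ?_ hj₁)
        have : a ^ (j₁ + 1 + i) ≤ a ^ j₁ := pow_le_pow_of_le_one ha0.le ha1.le (by omega)
        gcongr
      have h2 : x ^ (j₁ + 1 + i) ≤ x * (1 / 2) ^ i := by
        rw [add_assoc, add_comm 1 i, pow_add, pow_succ]
        calc x ^ j₁ * (x ^ i * x) ≤ 1 * ((1 / 2) ^ i * x) := by
              gcongr
              exact pow_le_one₀ hx0 (by linarith)
          _ = _ := by ring
      calc (K : ℝ) * B ^ (k n + (j₁ + 1 + i + 1)) * (C * √((1 / 2 : ℝ) ^ (j₁ + 1 + i))) ^ n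
          ≤ K * B ^ (k n + (j₁ + 1 + i + 1)) * (a ^ (j₁ + 1 + i)) ^ n := by gcongr
        _ = K * B ^ (k n + 1) * x ^ (j₁ + 1 + i) := by
            rw [hx, mul_pow, ← pow_mul, ← pow_mul, mul_comm n]; ring
        _ ≤ K * B ^ (k n + 1) * (x * (1 / 2) ^ i) := by gcongr
        _ = _ := by ring
    refine (measure_iUnion_le _).trans ((ENNReal.tsum_le_tsum hterm).trans ?_)
    rw [← ENNReal.ofReal_tsum_of_nonneg (fun i => by positivity)
      (summable_geometric_two.mul_left _), tsum_mul_left, tsum_geometric_two]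
    refine ENNReal.ofReal_le_ofReal (le_of_eq ?_)
    rw [hx]; ring
  filter_upwards [hE] with ω hω
  filter_upwards [hω] with n hn j hj hmem
  obtain ⟨i, rfl⟩ := Nat.exists_eq_add_of_le hj
  exact hn (Set.mem_iUnion.2 ⟨i, hmem⟩)

end BorelCantelli

/-! ### The constrained maximum likelihood estimator -/

section Estimator

variable {M : ℕ} {f : Fin M → ℝ → ℝ}

/-- The bound `b₀ exp (-n ^ d)` with `d < 1` is at least `2 ^ (-k n)` for some `k n = o(n)`. -/
lemma exists_pow_le_ratioBound {b₀ d : ℝ} (hb₀ : 0 < b₀) (hd₁ : d < 1) :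
    ∃ k : ℕ → ℕ, (∀ n : ℕ, (1 / 2 : ℝ) ^ k n ≤ b₀ * Real.exp (-((n : ℝ) ^ d))) ∧
      Tendsto (fun n => (k n : ℝ) / n) atTop (𝓝 0) := by
  have hl2 : 0 < Real.log 2 := Real.log_pos (by norm_num)
  refine ⟨fun n => ⌈((n : ℝ) ^ d + |Real.log b₀|) / Real.log 2⌉₊, fun n => ?_, ?_⟩
  · have h := Nat.le_ceil (((n : ℝ) ^ d + |Real.log b₀|) / Real.log 2)
    rw [div_le_iff₀ hl2] at h
    have e1 : (1 / 2 : ℝ) = Real.exp (-Real.log 2) := by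
      rw [Real.exp_neg, Real.exp_log (by norm_num)]; norm_num
    rw [e1, ← Real.exp_nat_mul]
    conv_rhs => rw [← Real.exp_log hb₀, ← Real.exp_add]
    rw [Real.exp_le_exp]
    have := neg_abs_le (Real.log b₀)
    linarith
  · have hup : Tendsto (fun n : ℕ => (n : ℝ) ^ (-(1 - d)) / Real.log 2 +
        (|Real.log b₀| / Real.log 2 + 1) / n) atTop (𝓝 (0 / Real.log 2 + 0)) := by
      refine Tendsto.add (Tendsto.div_const ?_ _) ?_
      · exact (tendsto_rpow_neg_atTop (by linarith)).comp tendsto_natCast_atTop_atTop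
      · exact tendsto_const_div_atTop_nhds_zero_nat _
    rw [zero_div, add_zero] at hup
    refine squeeze_zero' (Eventually.of_forall fun n => by positivity) ?_ hup
    filter_upwards [eventually_gt_atTop 0] with n hn
    have hn' : (0 : ℝ) < n := by exact_mod_cast hn
    have h := (Nat.ceil_lt_add_one (show 0 ≤ ((n : ℝ) ^ d + |Real.log b₀|) / Real.log 2 by
      positivity)).le
    have e : (n : ℝ) ^ (-(1 - d)) = (n : ℝ) ^ d / n := by
      rw [neg_sub, Real.rpow_sub_one hn'.ne']
    calc _ ≤ (((n : ℝ) ^ d + |Real.log b₀|) / Real.log 2 + 1) / n := by gcongr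
      _ = _ := by rw [e]; ring

lemma scaleMin_pos [Nonempty (Fin M)] {θ : Param M} (hθ : θ ∈ paramSpace M) : 0 < scaleMin θ := by
  obtain ⟨m, hm⟩ := exists_eq_ciInf_of_finite (f := scale θ)
  rw [scaleMin, ← hm]
  exact hθ.2.2 m

lemma scaleMin_le (θ : Param M) (m : Fin M) : scaleMin θ ≤ scale θ m :=
  ciInf_le (Set.finite_range _).bddBelow m

lemma le_scaleMax (θ : Param M) (m : Fin M) : scale θ m ≤ scaleMax θ :=
  le_ciSup (Set.finite_range _).bddAbove m

lemma scaleMax_pos [Nonempty (Fin M)] {θ : Param M} (hθ : θ ∈ paramSpace M) : 0 < scaleMax θ :=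
  (scaleMin_pos hθ).trans_le
    ((scaleMin_le θ (Classical.arbitrary _)).trans (le_scaleMax θ (Classical.arbitrary _)))

lemma mem_exceedSet_of_likelihood_le {Ω : Type*} {X : ℕ → Ω → ℝ} (hf : ∀ m x, 0 ≤ f m x)
    {θ θ₀ : Param M} (hθ : θ ∈ paramSpace M) {n : ℕ} {ω : Ω}
    (hpos : ∀ i, 0 < mixture f θ₀ (X i ω))
    (hle : likelihood f n (fun i => X i ω) θ₀ ≤ likelihood f n (fun i => X i ω) θ)
    {F : Set (ℝ → ℝ≥0∞)} (hF : rootMix f θ ∈ F) : ω ∈ exceedSet X (mixture f θ₀) n F := by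
  refine ⟨_, hF, ?_⟩
  simp only [rootMix]
  simp only [← ENNReal.ofReal_div_of_pos (Real.sqrt_pos.2 (hpos _))]
  rw [← ENNReal.ofReal_prod_of_nonneg fun i _ => by positivity, ENNReal.one_le_ofReal,
    Finset.prod_div_distrib, one_le_div (Finset.prod_pos fun i _ => Real.sqrt_pos.2 (hpos i)),
    ← Real.sqrt_prod _ fun i _ => (hpos i).le,
    ← Real.sqrt_prod _ fun i _ => mixture_nonneg hf hθ _]
  exact Real.sqrt_le_sqrt hle

/-- Almost surely, a constrained maximum likelihood estimator is eventually not among the parameters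
away from the truth. -/
lemma ae_eventually_notMem_awayParams (hf : ∀ m, IsDensity (f m)) {θ₀ : Param M}
    (hθ₀ : θ₀ ∈ paramSpace M) (h_meas : SupIsMeasurable f) (h_cont : ContinuousInParam f)
    (h_tail : TailBound f) (h_true : mixture f θ₀ ∉ mixtureClass f (M - 1))
    {Ω : Type*} [MeasurableSpace Ω] {P : Measure Ω} {X : ℕ → Ω → ℝ}
    (hX : IsIIDSample P X (mixture f θ₀)) {b₀ d : ℝ} (hb₀ : 0 < b₀) (hd₀ : 0 < d) (hd₁ : d < 1)
    {est : ℕ → Ω → Param M}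
    (h_est : ∀ᵐ ω ∂P, ∀ᶠ n : ℕ in atTop,
      IsMLE f (ratioSpace M (b₀ * Real.exp (-((n : ℝ) ^ d)))) n (fun i => X i ω) (est n ω))
    {ε : ℝ} (hε : 0 < ε) :
    ∀ᵐ ω ∂P, ∀ᶠ n in atTop, est n ω ∉ awayParams f θ₀ ε := by
  have hM : Nonempty (Fin M) := by
    by_contra h
    rw [not_nonempty_iff] at h
    simpa using hθ₀.2.1
  have hf0 : ∀ m x, 0 ≤ f m x := fun m => (hf m).nonneg
  have hden := isDensity_mixture hf hθ₀
  have hmeas₀ : AEMeasurable (mixture f θ₀) volume := hden.integrable.aemeasurable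
  obtain ⟨A, τ, hA, hτ, hroot⟩ := h_tail.exists_rootTail
  obtain ⟨D, hD, hw⟩ := hroot.exists_rootMix_le hf0 hA.le hτ.le hθ₀
  have hwm : AEMeasurable (rootMix f θ₀) volume := hmeas₀.sqrt.ennreal_ofReal
  have hwt : ∫⁻ x, rootMix f θ₀ x ≠ ∞ := by
    refine ne_top_of_le_ne_top ?_ (lintegral_mono hw)
    exact ((integrable_one_add_abs_rpow (by linarith)).const_mul D).lintegral_lt_top.ne
  have haff : ∀ θ ∈ awayParams f θ₀ ε, ∫⁻ x, rootMix f θ x * rootMix f θ₀ x < 1 := fun θ hθ =>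
    lintegral_sqrt_mul_sqrt_lt_one (isDensity_mixture hf hθ.1) hden
      (not_ae_eq_of_mem_awayParams hε h_true hθ)
  obtain ⟨k, hkb, hk⟩ := exists_pow_le_ratioBound hb₀ hd₁
  obtain ⟨C, hC, K, B, hB, hsmall⟩ := exists_upperCover_all_small hroot hf0 hA.le hτ hD hwm hw
  obtain ⟨j₀, hj₀⟩ := exists_ae_eventually_notMem_exceedSet hX hmeas₀ hC hB hsmall hk
  obtain ⟨c, hc, K', B', hB', haway⟩ :=
    exists_upperCover_awayParams hroot hf0 hA.le hτ hD hwm hw hwt h_meas h_cont haff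
  have hlarge := ae_eventually_notMem_exceedSet hX hmeas₀ hc hB' haway hk (j₀ + 1)
  have hθ₀b : ∀ᶠ n : ℕ in atTop, θ₀ ∈ ratioSpace M (b₀ * Real.exp (-((n : ℝ) ^ d))) := by
    have hlim : Tendsto (fun n : ℕ => b₀ * Real.exp (-((n : ℝ) ^ d))) atTop (𝓝 (b₀ * 0)) :=
      (Real.tendsto_exp_neg_atTop_nhds_zero.comp
        ((tendsto_rpow_atTop hd₀).comp tendsto_natCast_atTop_atTop)).const_mul b₀
    rw [mul_zero] at hlim
    filter_upwards [hlim.eventually_lt_const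
      (div_pos (scaleMin_pos hθ₀) (scaleMax_pos hθ₀))] with n hn
    exact ⟨hθ₀, hn.le⟩
  filter_upwards [h_est, hj₀, hlarge, hX.ae_pos hmeas₀] with ω hω hA' hB'' hpos
  filter_upwards [hω, hA', hB'', hθ₀b] with n ⟨hS, hmax⟩ hns hnl hθ₀n hmem
  have hΘ := hS.1
  have hlik := hmax hθ₀n
  have hmaxpos := scaleMax_pos hΘ
  have hlow : ∀ m, (1 / 2 : ℝ) ^ k n * scaleMax (est n ω) ≤ scale (est n ω) m := by
    intro m
    have h1 := hS.2
    rw [le_div_iff₀ hmaxpos] at h1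
    calc _ ≤ b₀ * Real.exp (-((n : ℝ) ^ d)) * scaleMax (est n ω) := by gcongr; exact hkb n
      _ ≤ _ := h1.trans (scaleMin_le _ m)
  have hexceed : ∀ F : Set (ℝ → ℝ≥0∞), rootMix f (est n ω) ∈ F →
      ω ∈ exceedSet X (mixture f θ₀) n F := fun F hF =>
    mem_exceedSet_of_likelihood_le hf0 hΘ hpos hlik hF
  rcases le_or_gt ((1 / 2 : ℝ) ^ (j₀ + 1)) (scaleMax (est n ω)) with hmx | hmx
  · refine hnl (hexceed _ ⟨_, hmem, fun m => le_trans ?_ (hlow m), rfl⟩)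
    rw [pow_add]
    gcongr
  · obtain ⟨j, hj1, hj2⟩ := exists_nat_pow_near_of_lt_one hmaxpos
      (hmx.le.trans (pow_le_one₀ (by norm_num) (by norm_num))) (by norm_num : (0 : ℝ) < 1 / 2)
      (by norm_num)
    have hj : j₀ ≤ j := by
      have := (pow_lt_pow_iff_right_of_lt_one₀ (by norm_num : (0 : ℝ) < 1 / 2)
        (by norm_num)).1 (hj1.trans hmx)
      omega
    refine hns j hj (hexceed _ ⟨_, hΘ, fun m => ⟨le_trans ?_ (hlow m),
      (le_scaleMax _ m).trans hj2⟩, rfl⟩)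
    rw [pow_add]
    gcongr

end Estimator

end LocScaleMixture

theorem corollary1 {M : ℕ} (f : Fin M → ℝ → ℝ) (hf : ∀ m, IsDensity (f m))
    (θ₀ : Param M) (hθ₀ : θ₀ ∈ paramSpace M)
    (h_meas : SupIsMeasurable f) (h_cont : ContinuousInParam f)
    (h_log : FiniteLogIntegral f θ₀) (h_tail : TailBound f)
    (h_true : mixture f θ₀ ∈ mixtureClass f M \ mixtureClass f (M - 1))
    {Ω : Type*} [MeasurableSpace Ω] (P : Measure Ω) [IsProbabilityMeasure P]
    (X : ℕ → Ω → ℝ) (hX : IsIIDSample P X (mixture f θ₀))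
    (b₀ d : ℝ) (hb₀ : 0 < b₀) (hd₀ : 0 < d) (hd₁ : d < 1)
    (est : ℕ → Ω → Param M)
    (h_est : ∀ᵐ ω ∂P, ∀ᶠ n : ℕ in atTop,
      IsMLE f (ratioSpace M (b₀ * Real.exp (-((n : ℝ) ^ d)))) n (fun i => X i ω) (est n ω)) :
    StronglyConsistent P f θ₀ est := by
  have key : ∀ᵐ ω ∂P, ∀ j : ℕ, ∀ᶠ n in atTop, est n ω ∉ awayParams f θ₀ (1 / (j + 1)) :=
    ae_all_iff.2 fun j => ae_eventually_notMem_awayParams hf hθ₀ h_meas h_cont h_tail h_true.2 hX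
      hb₀ hd₀ hd₁ h_est (by positivity)
  filter_upwards [key, h_est] with ω hω hmle
  refine ENNReal.tendsto_nhds_zero.2 fun δ hδ => ?_
  obtain ⟨j, hj⟩ : ∃ j : ℕ, ENNReal.ofReal (1 / (j + 1)) ≤ δ := by
    have h := (ENNReal.continuous_ofReal.tendsto 0).comp
      (tendsto_one_div_add_atTop_nhds_zero_nat (𝕜 := ℝ))
    rw [ENNReal.ofReal_zero] at h
    exact ((h.eventually_lt_const hδ).exists).imp fun _ h => h.le
  filter_upwards [hω j, hmle] with n hn hm
  have hΘ := hm.1.1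
  obtain ⟨θ', hθ', hd⟩ : ∃ θ' ∈ equivParams f θ₀, dist (est n ω) θ' < 1 / (j + 1) := by
    by_contra! hcon
    exact hn ⟨hΘ, Or.inl hcon⟩
  refine le_trans ?_ hj
  refine (iInf₂_le (est n ω) (show est n ω ∈ equivParams f (est n ω) from
    ⟨hΘ, EventuallyEq.rfl⟩)).trans ((iInf₂_le θ' hθ').trans ?_)
  rw [edist_dist]
  exact ENNReal.ofReal_le_ofReal hd.le
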